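/- **Representation theorem for local operator systems.** *Abstract side.* Let $V$ be a complex $*$-vector space (a complex vector space with a conjugate-linear involution); $M_n(V)$ carries the involution $[v_{ij}]^*=[v_{ji}^*]$. An *abstract local operator system* is a triple $(V,\{\{\mathcal C_\alpha^n\}_{n}:\alpha\in\Gamma\},e)$ with $\Gamma\neq\emptyset$ such that: 1. each $\mathcal C^n_\alpha$ is a (not necessarily proper) cone of hermitian elements of $M_n(V)$, and $\bigcap_{\alpha}(\mathcal C^n_\alpha\cap-\mathcal C^n_\alpha)=\{0\}$ for each $n$; 2. the family is downward filtered: for $\alpha,\beta\in\Gamma$ there is $\gamma\in\Gamma$ with $\mathcal C^n_\gamma\subseteq\mathcal C^n_\alpha\cap\mathcal C^n_\beta$ for all $n$; 3. $X^*\mathcal C^n_\alpha X\subseteq\mathcal C^m_\alpha$ for all $\alpha$ and all scalar matrices $X\in M_{n,m}(\mathbb C)$; 4. $e=e^*\in V$ is an Archimedean matrix order unit: with $e_n=\mathrm{diag}(e,\dots,e)$, for all $n$ and $\alpha$, every hermitian $v\in M_n(V)$ satisfies $re_n-v\in\mathcal C^n_\alpha$ for some $r>0$, and if $v\in M_n(V)$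 satisfies $re_n+v\in\mathcal C^n_\alpha$ for all $r>0$, then $v\in\mathcal C^n_\alpha$. *Concrete side.* A *quantized domain* $\mathcal E=\{H_\alpha\}_{\alpha\in\Gamma}$ in a Hilbert space $H$ is a non-empty upward filtered family of closed subspaces whose union $\mathcal D$ is dense in $H$; let $P_\alpha$ be the projection of $H$ onto $H_\alpha$. $C^*_{\mathcal E}(\mathcal D)$ is the unital $*$-algebra of all linear maps $T:\mathcal D\to\mathcal D$ such that, for each $\alpha$, $T(H_\alpha)\subseteq H_\alpha$, $T|_{H_\alpha}$ is bounded and $P_\alpha Tx=TP_\alpha x$ for $x\in\mathcal D$; the involution is $T^*=T^{\bigstar}|_{\mathcal D}$, where $T^{\bigstar}$ is the unbounded adjoint. Its matrix cones are $$\mathcal K^n_\alpha=\{A\in M_n(C^*_{\mathcal E}(\mathcal D)) : A=A^*,\ A|_{H_\alpha^n}\ge 0 \text{ in } B(H_\alpha^n)\}.$$ A *concrete local operator system* is a unital self-adjoint subspace $S\subseteq C^*_{\mathcal E}(\mathcal D)$, with unit $I$ and cones $M_n(S)\cap\mathcal K^n_\alpha$. A *unital complete local order embedding* between such systems with the same index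 set $\Gamma$ is an injective, linear, $*$-preserving, unital map $\Phi$ such that, for all $\alpha$, all $n$ and all $A\in M_n(V)$, $A$ lies in the $\alpha$-th cone of $M_n(V)$ if and only if $\Phi^{(n)}(A)$ lies in the $\alpha$-th cone at level $n$ of the target. It is a *unital complete local order isomorphism* if it is moreover surjective. **Theorem.** (a) For every abstract local operator system $V$ with index set $\Gamma$ there are a Hilbert space $H$, a quantized domain $\mathcal E=\{H_\alpha\}_{\alpha\in\Gamma}$ in $H$ with union $\mathcal D$, and a unital complete local order embedding $\Phi:V\to C^*_{\mathcal E}(\mathcal D)$. (b) Hence abstract and concrete local operator systems are equivalent: every abstract local operator system is unitally completely locally order isomorphic to a concrete one, and every concrete local operator system is an abstract local operator system. -/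

import Mathlib

open scoped InnerProductSpace ComplexOrder LinearPMap

universe u v

noncomputable section

namespace LocalOperatorSystem

/-! ## Abstract local operator systems

A `*`-vector space is a complex vector space with a conjugate-linear involution:
`[AddCommGroup V] [Module ℂ V] [StarAddMonoid V] [StarModule ℂ V]`.
For such a `V`, the space `M_n(V) = Matrix (Fin n) (Fin n) V` is again a `*`-vector space with
`star [v_ij] = [star v_ji]`. -/

section Abstract

/-- A (not necessarily proper) cone: it contains `0` and is closed under sums and under
multiplication by non-negative reals. -/
structure IsCone {W : Type*} [AddCommGroup W] [Module ℂ W] (K : Set W) : Prop where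
  zero_mem : 0 ∈ K
  add_mem : ∀ v ∈ K, ∀ w ∈ K, v + w ∈ K
  smul_mem : ∀ r : ℝ, 0 ≤ r → ∀ v ∈ K, (r : ℂ) • v ∈ K

/-- A local `*`-ordered vector space: a `*`-vector space with a downward filtered (non-empty)
family of cones of hermitian elements such that `⋂ α, (C α ∩ -C α) = {0}`. -/
structure IsLocalStarOrdered {W : Type*} [AddCommGroup W] [Module ℂ W] [StarAddMonoid W]
    {Γ : Type*} (C : Γ → Set W) : Prop where
  nonempty : Nonempty Γ
  filtered : ∀ α β, ∃ γ, C γ ⊆ C α ∧ C γ ⊆ C β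
  isCone : ∀ α, IsCone (C α)
  hermitian : ∀ α, ∀ v ∈ C α, star v = v
  inter_eq : {v : W | ∀ α, v ∈ C α ∧ -v ∈ C α} = {0}

/-- `e` is an order unit: `e` is hermitian, and for every hermitian `v` and every `α` some
`r > 0` satisfies `r e ≥_α v`. -/
structure IsOrderUnit {W : Type*} [AddCommGroup W] [Module ℂ W] [StarAddMonoid W]
    {Γ : Type*} (C : Γ → Set W) (e : W) : Prop where
  star_eq : star e = e
  exists_le : ∀ v : W, star v = v → ∀ α, ∃ r : ℝ, 0 < r ∧ (r : ℂ) • e - v ∈ C α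

/-- `e` is an Archimedean order unit: an order unit such that, for each `α`,
`r e + v ∈ C α` for all `r > 0` forces `v ∈ C α`. -/
structure IsArchimedeanOrderUnit {W : Type*} [AddCommGroup W] [Module ℂ W] [StarAddMonoid W]
    {Γ : Type*} (C : Γ → Set W) (e : W) : Prop extends IsOrderUnit C e where
  archimedean : ∀ α, ∀ v : W, (∀ r : ℝ, 0 < r → (r : ℂ) • e + v ∈ C α) → v ∈ C α

/-- The matrix `X* A X ∈ M_m(V)` for `A ∈ M_n(V)` and a scalar matrix `X ∈ M_{n,m}`. -/
def conj {V : Type*} [AddCommGroup V] [Module ℂ V] {n m : ℕ}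
    (X : Matrix (Fin n) (Fin m) ℂ) (A : Matrix (Fin n) (Fin n) V) : Matrix (Fin m) (Fin m) V :=
  Matrix.of fun i j => ∑ k, ∑ l, (star (X k i) * X l j) • A k l

/-- A local matrix ordering `{C α n}` on `V`. The family is downward filtered as a family of
matrix cones: the index `γ` below `α` and `β` works at all matrix levels. -/
structure IsLocalMatrixOrdering {V : Type*} [AddCommGroup V] [Module ℂ V] [StarAddMonoid V]
    {Γ : Type*} (C : Γ → ∀ n : ℕ, Set (Matrix (Fin n) (Fin n) V)) : Prop where
  level : ∀ n : ℕ, IsLocalStarOrdered fun α => C α n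
  filtered : ∀ α β, ∃ γ, ∀ n, C γ n ⊆ C α n ∧ C γ n ⊆ C β n
  compatible : ∀ (α : Γ) (n m : ℕ) (X : Matrix (Fin n) (Fin m) ℂ), ∀ A ∈ C α n, conj X A ∈ C α m

/-- `(V, {C α n}, e)` is an abstract local operator system: `{C α n}` is a local matrix ordering
on the `*`-vector space `V` and `e` is an Archimedean matrix order unit, that is,
`diag(e, …, e)` is an Archimedean order unit at every matrix level. -/
structure IsAbstract {V : Type*} [AddCommGroup V] [Module ℂ V] [StarAddMonoid V]
    {Γ : Type*} (C : Γ → ∀ n : ℕ, Set (Matrix (Fin n) (Fin n) V)) (e : V) : Prop where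
  ordering : IsLocalMatrixOrdering C
  star_unit : star e = e
  unit : ∀ n : ℕ, IsArchimedeanOrderUnit (fun α => C α n) (Matrix.diagonal fun _ : Fin n => e)

/-- `Φ : V → W` is a unital complete local order embedding, for matrix cones `C` on `V` and `D`
on `W` that are indexed by the same set, and units `e`, `f`: it is linear, injective,
`*`-preserving and unital, and `A ∈ M_n(V)` lies in `C α n` exactly when `[Φ(A_ij)]` lies in
`D α n`, for all `α` and `n`. In other words, `Φ⁽ⁿ⁾(C α n) = D α n ∩ Φ⁽ⁿ⁾(M_n(V))`. -/
structure IsOrderEmbedding {V W : Type*} [AddCommGroup V] [Module ℂ V] [StarAddMonoid V]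
    [AddCommGroup W] [Module ℂ W] [StarAddMonoid W] {Γ : Type*}
    (C : Γ → ∀ n : ℕ, Set (Matrix (Fin n) (Fin n) V)) (e : V)
    (D : Γ → ∀ n : ℕ, Set (Matrix (Fin n) (Fin n) W)) (f : W) (Φ : V →ₗ[ℂ] W) : Prop where
  injective : Function.Injective Φ
  map_star : ∀ v, Φ (star v) = star (Φ v)
  map_unit : Φ e = f
  mem_iff : ∀ (α : Γ) (n : ℕ) (A : Matrix (Fin n) (Fin n) V), A ∈ C α n ↔ A.map Φ ∈ D α n

/-- A unital complete local order isomorphism: a surjective unital complete local order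
embedding; so `Φ⁽ⁿ⁾(C α n) = D α n` for all `α` and `n`. -/
structure IsOrderIso {V W : Type*} [AddCommGroup V] [Module ℂ V] [StarAddMonoid V]
    [AddCommGroup W] [Module ℂ W] [StarAddMonoid W] {Γ : Type*}
    (C : Γ → ∀ n : ℕ, Set (Matrix (Fin n) (Fin n) V)) (e : V)
    (D : Γ → ∀ n : ℕ, Set (Matrix (Fin n) (Fin n) W)) (f : W) (Φ : V →ₗ[ℂ] W) : Prop
    extends IsOrderEmbedding C e D f Φ where
  surjective : Function.Surjective Φ

end Abstract

/-! ## Quantized domains and the algebras `C_E(D)` and `C*_E(D)` -/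

/-- A quantized domain in the Hilbert space `H`: an upward filtered (non-empty) family of closed
subspaces whose union is dense in `H`. -/
structure QuantizedDomain (Γ : Type v) (H : Type u) [NormedAddCommGroup H]
    [InnerProductSpace ℂ H] where
  space : Γ → Submodule ℂ H
  nonempty : Nonempty Γ
  isClosed_space : ∀ α, IsClosed (space α : Set H)
  directed : Directed (· ≤ ·) space
  dense_iUnion : Dense (⋃ α, (space α : Set H))

namespace QuantizedDomain

variable {Γ : Type v} {H : Type u} [NormedAddCommGroup H] [InnerProductSpace ℂ H]
  (E : QuantizedDomain Γ H)

/-- The union space `D = ⋃ α, H_α` (see `mem_domain`), a dense subspace of `H`. -/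
def domain : Submodule ℂ H := ⨆ α, E.space α

theorem mem_domain {x : H} : x ∈ E.domain ↔ ∃ α, x ∈ E.space α := by
  have := E.nonempty
  exact Submodule.mem_iSup_of_directed _ E.directed

theorem dense_domain : Dense (E.domain : Set H) := by
  have h : (E.domain : Set H) = ⋃ α, (E.space α : Set H) := by
    ext x
    simp [E.mem_domain]
  rw [h]
  exact E.dense_iUnion

theorem space_le_domain (α : Γ) : E.space α ≤ E.domain := le_iSup E.space α

/-- The algebra `C_E(D)` of linear maps `T : D → D` such that, for all `α`, `T` maps `H_α` into
`H_α` and the restriction of `T` to `H_α` is bounded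
(equivalently `T P_α = P_α T P_α ∈ B(H)`, with `P_α` the projection onto `H_α`). -/
def contAlgebra : Subalgebra ℂ (Module.End ℂ E.domain) where
  carrier := {T | ∀ α, (∀ x : E.domain, (x : H) ∈ E.space α → (T x : H) ∈ E.space α) ∧
    ∃ M : ℝ, ∀ x : E.domain, (x : H) ∈ E.space α → ‖T x‖ ≤ M * ‖x‖}
  mul_mem' := by
    intro S T hS hT α
    refine ⟨fun x hx => (hS α).1 _ ((hT α).1 x hx), ?_⟩
    obtain ⟨M, hM⟩ := (hS α).2
    obtain ⟨N, hN⟩ := (hT α).2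
    refine ⟨|M| * N, fun x hx => ?_⟩
    calc ‖S (T x)‖ ≤ M * ‖T x‖ := hM _ ((hT α).1 x hx)
      _ ≤ |M| * ‖T x‖ := by gcongr; exact le_abs_self M
      _ ≤ |M| * (N * ‖x‖) := by gcongr; exact hN x hx
      _ = |M| * N * ‖x‖ := by ring
  add_mem' := by
    intro S T hS hT α
    refine ⟨fun x hx => (E.space α).add_mem ((hS α).1 x hx) ((hT α).1 x hx), ?_⟩
    obtain ⟨M, hM⟩ := (hS α).2
    obtain ⟨N, hN⟩ := (hT α).2
    refine ⟨M + N, fun x hx => ?_⟩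
    calc ‖S x + T x‖ ≤ ‖S x‖ + ‖T x‖ := norm_add_le _ _
      _ ≤ M * ‖x‖ + N * ‖x‖ := add_le_add (hM x hx) (hN x hx)
      _ = (M + N) * ‖x‖ := by ring
  algebraMap_mem' := by
    intro c α
    refine ⟨fun x hx => (E.space α).smul_mem c hx, ‖c‖, fun x _ => ?_⟩
    exact (norm_smul c x).le

variable [CompleteSpace H]

instance instCompleteSpaceSpace (α : Γ) : CompleteSpace (E.space α) :=
  (E.isClosed_space α).completeSpace_coe

/-- `P_α x` as an element of `D`, for `x ∈ D`. -/
def proj (α : Γ) (x : E.domain) : E.domain :=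
  ⟨(E.space α).starProjection x,
    E.space_le_domain α ((E.space α).starProjection_apply_mem x)⟩

/-- The multinormed algebra `C*_E(D) = {T ∈ C_E(D) : P_α T ⊆ T P_α for all α}`. -/
def starAlgebra : Subalgebra ℂ (Module.End ℂ E.domain) where
  carrier := {T | T ∈ E.contAlgebra ∧ ∀ α x, E.proj α (T x) = T (E.proj α x)}
  mul_mem' := by
    intro S T hS hT
    refine ⟨E.contAlgebra.mul_mem hS.1 hT.1, fun α x => ?_⟩
    change E.proj α (S (T x)) = S (T (E.proj α x))
    rw [hS.2, hT.2]
  add_mem' := by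
    intro S T hS hT
    refine ⟨E.contAlgebra.add_mem hS.1 hT.1, fun α x => ?_⟩
    rw [LinearMap.add_apply, LinearMap.add_apply, ← hS.2, ← hT.2]
    ext
    simp [proj]
  algebraMap_mem' := by
    intro c
    refine ⟨E.contAlgebra.algebraMap_mem c, fun α x => ?_⟩
    ext
    simp [proj]

/-- The type of elements of `C*_E(D)`, a complex algebra under composition. -/
def CStar : Type u := E.starAlgebra

variable {E}

instance instRing : Ring E.CStar := inferInstanceAs (Ring E.starAlgebra)

instance instAlgebra : Algebra ℂ E.CStar := inferInstanceAs (Algebra ℂ E.starAlgebra)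

/-- An element of `C*_E(D)` as a densely defined unbounded operator on `H` with domain `D`. -/
def toPMap (T : E.CStar) : H →ₗ.[ℂ] H where
  domain := E.domain
  toFun := E.domain.subtype ∘ₗ T.1

theorem starProjection_eq {α : Γ} {x : H} (hx : x ∈ E.space α) :
    (E.space α).starProjection x = x :=
  Submodule.starProjection_eq_self_iff.mpr hx

theorem inner_starProjection (α : Γ) (x y : H) :
    ⟪(E.space α).starProjection x, y⟫_ℂ = ⟪x, (E.space α).starProjection y⟫_ℂ :=
  Submodule.inner_starProjection_left_eq_right _ _ _

/-- For `y ∈ H_α` the functional `x ↦ ⟪y, T x⟫` factors through `P_α`. -/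
theorem inner_apply_eq (T : E.CStar) {α : Γ} {y : H} (hy : y ∈ E.space α) (x : E.domain) :
    ⟪y, (T.1 x : H)⟫_ℂ = ⟪y, (T.1 (E.proj α x) : H)⟫_ℂ := by
  have h : (T.1 (E.proj α x) : H) = (E.space α).starProjection (T.1 x : H) := by
    rw [← T.2.2 α x]
    rfl
  rw [h, ← inner_starProjection, starProjection_eq hy]

/-- `D ⊆ dom(T^★)`. -/
theorem domain_le_adjoint_domain (T : E.CStar) : E.domain ≤ (toPMap T)†.domain := by
  intro y hy
  obtain ⟨α, hα⟩ := E.mem_domain.mp hy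
  rw [LinearPMap.mem_adjoint_domain_iff]
  obtain ⟨M, hM⟩ := (T.2.1 α).2
  refine AddMonoidHomClass.continuous_of_bound _ (‖y‖ * |M|) fun x => ?_
  change ‖⟪y, (T.1 x : H)⟫_ℂ‖ ≤ ‖y‖ * |M| * ‖x‖
  rw [inner_apply_eq T hα x]
  have hmem : ((E.proj α x : E.domain) : H) ∈ E.space α :=
    (E.space α).starProjection_apply_mem _
  have h1 : ‖E.proj α x‖ ≤ ‖x‖ := (E.space α).norm_starProjection_apply_le (x : H)
  calc ‖⟪y, (T.1 (E.proj α x) : H)⟫_ℂ‖ ≤ ‖y‖ * ‖T.1 (E.proj α x)‖ := norm_inner_le_norm _ _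
    _ ≤ ‖y‖ * (M * ‖E.proj α x‖) := by gcongr; exact hM _ hmem
    _ ≤ ‖y‖ * (|M| * ‖x‖) := by gcongr; exact le_abs_self M
    _ = ‖y‖ * |M| * ‖x‖ := by ring

/-- The defining relation of the unbounded adjoint `T^★` on `D`. -/
theorem adjoint_inner (T : E.CStar) (y : (toPMap T)†.domain) (x : E.domain) :
    ⟪(toPMap T)† y, (x : H)⟫_ℂ = ⟪(y : H), (T.1 x : H)⟫_ℂ :=
  LinearPMap.adjoint_isFormalAdjoint (T := toPMap T) E.dense_domain y x

/-- `T^★` leaves each `H_α` invariant; hence `T^★(D) ⊆ D`. -/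
theorem adjoint_mem_space (T : E.CStar) (y : (toPMap T)†.domain) {α : Γ}
    (hy : (y : H) ∈ E.space α) : (toPMap T)† y ∈ E.space α := by
  have key : (E.space α).starProjection ((toPMap T)† y) = (toPMap T)† y := by
    refine E.dense_domain.eq_of_inner_left (𝕜 := ℂ) fun x hx => ?_
    have h1 := adjoint_inner T y (E.proj α ⟨x, hx⟩)
    have h2 := adjoint_inner T y ⟨x, hx⟩
    rw [← inner_apply_eq T hy] at h1
    rw [inner_starProjection, h2]
    exact h1
  rw [← key]
  exact (E.space α).starProjection_apply_mem _

/-- The linear map `T* = T^★|_D : D → D`, where `T^★` is the unbounded adjoint of `T`. -/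
def starFun (T : E.CStar) : Module.End ℂ E.domain where
  toFun y := ⟨(toPMap T)† ⟨y, domain_le_adjoint_domain T y.2⟩, by
    obtain ⟨α, hα⟩ := E.mem_domain.mp y.2
    exact E.space_le_domain α (adjoint_mem_space T _ hα)⟩
  map_add' y z := Subtype.ext
    ((toPMap T)†.map_add ⟨y, domain_le_adjoint_domain T y.2⟩ ⟨z, domain_le_adjoint_domain T z.2⟩)
  map_smul' c y := Subtype.ext
    ((toPMap T)†.map_smul c ⟨y, domain_le_adjoint_domain T y.2⟩)

theorem starFun_inner (T : E.CStar) (y x : E.domain) :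
    ⟪starFun T y, x⟫_ℂ = ⟪y, T.1 x⟫_ℂ :=
  adjoint_inner T ⟨y, domain_le_adjoint_domain T y.2⟩ x

theorem starFun_mem (T : E.CStar) : starFun T ∈ E.starAlgebra := by
  refine ⟨fun α => ⟨fun x hx => adjoint_mem_space T _ hx, ?_⟩, fun α x => ?_⟩
  · obtain ⟨M, hM⟩ := (T.2.1 α).2
    refine ⟨|M|, fun x hx => ?_⟩
    have hmem : (starFun T x : H) ∈ E.space α := adjoint_mem_space T _ hx
    have h1 : ‖starFun T x‖ * ‖starFun T x‖ ≤ |M| * ‖x‖ * ‖starFun T x‖ := by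
      calc ‖starFun T x‖ * ‖starFun T x‖ = ‖⟪starFun T x, starFun T x⟫_ℂ‖ := by
            rw [inner_self_eq_norm_sq_to_K]
            simp [sq]
        _ = ‖⟪x, T.1 (starFun T x)⟫_ℂ‖ := by rw [starFun_inner]
        _ ≤ ‖x‖ * ‖T.1 (starFun T x)‖ := norm_inner_le_norm _ _
        _ ≤ ‖x‖ * (M * ‖starFun T x‖) := by gcongr; exact hM _ hmem
        _ ≤ ‖x‖ * (|M| * ‖starFun T x‖) := by gcongr; exact le_abs_self M
        _ = |M| * ‖x‖ * ‖starFun T x‖ := by ring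
    rcases (norm_nonneg (starFun T x)).eq_or_lt with h0 | h0
    · rw [← h0]
      positivity
    · exact le_of_mul_le_mul_right h1 h0
  · have hp : ∀ y z : E.domain, ⟪E.proj α y, z⟫_ℂ = ⟪y, E.proj α z⟫_ℂ :=
      fun y z => inner_starProjection α (y : H) (z : H)
    refine ext_inner_right ℂ fun y => ?_
    rw [hp, starFun_inner, starFun_inner, hp, T.2.2]

/-- The involution `T* = T^★|_D` of `C*_E(D)`. -/
instance instStar : Star E.CStar := ⟨fun T => ⟨starFun T, starFun_mem T⟩⟩

theorem star_inner (T : E.CStar) (y x : E.domain) :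
    ⟪(star T).1 y, x⟫_ℂ = ⟪y, T.1 x⟫_ℂ := starFun_inner T y x

theorem ext_of_inner {S T : E.CStar}
    (h : ∀ y x : E.domain, ⟪S.1 y, x⟫_ℂ = ⟪T.1 y, x⟫_ℂ) : S = T :=
  Subtype.ext (LinearMap.ext fun y => ext_inner_right ℂ (h y))

theorem star_inner' (T : E.CStar) (y x : E.domain) :
    ⟪T.1 y, x⟫_ℂ = ⟪y, (star T).1 x⟫_ℂ := by
  rw [← inner_conj_symm, ← star_inner, inner_conj_symm]

/-- `C*_E(D)` is a `*`-algebra. -/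
instance instStarRing : StarRing E.CStar where
  star_involutive T := ext_of_inner fun y x => by rw [star_inner, ← star_inner']
  star_mul S T := ext_of_inner fun y x => by
    rw [star_inner]
    change ⟪y, S.1 (T.1 x)⟫_ℂ = ⟪(star T).1 ((star S).1 y), x⟫_ℂ
    rw [star_inner, star_inner]
  star_add S T := ext_of_inner fun y x => by
    rw [star_inner]
    change ⟪y, S.1 x + T.1 x⟫_ℂ = ⟪(star S).1 y + (star T).1 y, x⟫_ℂ
    rw [inner_add_left, inner_add_right, star_inner, star_inner]

instance instStarModule : StarModule ℂ E.CStar where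
  star_smul c T := ext_of_inner fun y x => by
    rw [star_inner]
    change ⟪y, c • T.1 x⟫_ℂ = ⟪star c • (star T).1 y, x⟫_ℂ
    rw [inner_smul_left, inner_smul_right, star_inner]
    simp

/-- The restriction `T|_{H_α} ∈ B(H_α)` of `T ∈ C*_E(D)`. -/
def restrict (T : E.CStar) (α : Γ) : E.space α →L[ℂ] E.space α :=
  LinearMap.mkContinuousOfExistsBound
    { toFun := fun x => ⟨T.1 ⟨x, E.space_le_domain α x.2⟩, (T.2.1 α).1 _ x.2⟩
      map_add' := fun x y => Subtype.ext <| congrArg (Subtype.val : E.domain → H) <|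
        T.1.map_add ⟨x, E.space_le_domain α x.2⟩ ⟨y, E.space_le_domain α y.2⟩
      map_smul' := fun c x => Subtype.ext <| congrArg (Subtype.val : E.domain → H) <|
        T.1.map_smul c ⟨x, E.space_le_domain α x.2⟩ }
    (by
      obtain ⟨M, hM⟩ := (T.2.1 α).2
      exact ⟨M, fun x => hM ⟨x, E.space_le_domain α x.2⟩ x.2⟩)

/-- The operator `A|_{H_α^n} ∈ B(H_α^n)` given by a matrix `A ∈ M_n(C*_E(D))` on the Hilbert
space direct sum `H_α^n`: it maps `(ξ_j)` to `(∑ j, A_ij ξ_j)`. -/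
def matrixRestrict {n : ℕ} (A : Matrix (Fin n) (Fin n) E.CStar) (α : Γ) :
    PiLp 2 (fun _ : Fin n => E.space α) →L[ℂ] PiLp 2 (fun _ : Fin n => E.space α) :=
  (PiLp.continuousLinearEquiv 2 ℂ (fun _ : Fin n => E.space α)).symm.toContinuousLinearMap ∘L
    ContinuousLinearMap.pi fun i => ∑ j, restrict (A i j) α ∘L PiLp.proj 2 _ j

theorem matrixRestrict_apply {n : ℕ} (A : Matrix (Fin n) (Fin n) E.CStar) (α : Γ)
    (ξ : PiLp 2 (fun _ : Fin n => E.space α)) (i : Fin n) :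
    matrixRestrict A α ξ i = ∑ j, restrict (A i j) α (ξ j) := by
  simp [matrixRestrict]

variable (E) in
/-- The canonical matrix cones of `C*_E(D)`: the hermitian matrices `A ∈ M_n(C*_E(D))` with
`A|_{H_α^n} ≥ 0` in `B(H_α^n)`. -/
def cone (α : Γ) (n : ℕ) : Set (Matrix (Fin n) (Fin n) E.CStar) :=
  {A | star A = A ∧ (matrixRestrict A α).IsPositive}

end QuantizedDomain

/-! ## Concrete local operator systems -/

/-- A concrete local operator system: a unital self-adjoint subspace of `C*_E(D)`. -/
structure Concrete {Γ : Type v} {H : Type u} [NormedAddCommGroup H] [InnerProductSpace ℂ H]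
    [CompleteSpace H] (E : QuantizedDomain Γ H) where
  carrier : Submodule ℂ E.CStar
  one_mem : 1 ∈ carrier
  star_mem : ∀ T ∈ carrier, star T ∈ carrier

namespace Concrete

variable {Γ : Type v} {H : Type u} [NormedAddCommGroup H] [InnerProductSpace ℂ H]
  [CompleteSpace H] {E : QuantizedDomain Γ H} (S : Concrete E)

instance instStarAddMonoid : StarAddMonoid S.carrier where
  star T := ⟨star T.1, S.star_mem _ T.2⟩
  star_involutive T := Subtype.ext (star_star T.1)
  star_add T U := Subtype.ext (star_add T.1 U.1)

instance instStarModule : StarModule ℂ S.carrier where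
  star_smul c T := Subtype.ext (star_smul c T.1)

/-- The identity operator as an element of `S`. -/
def unit : S.carrier := ⟨1, S.one_mem⟩

/-- The matrix cones of `S`, inherited from `C*_E(D)`: `C α n = M_n(S) ∩ E.cone α n`. -/
def cone (α : Γ) (n : ℕ) : Set (Matrix (Fin n) (Fin n) S.carrier) :=
  {A | A.map (Subtype.val : S.carrier → E.CStar) ∈ E.cone α n}

end Concrete

end LocalOperatorSystem

end

noncomputable section

namespace LocalOperatorSystem

/-! ## Concrete local operator systems are abstract ones -/

namespace QuantizedDomain

variable {Γ : Type v} {H : Type u} [NormedAddCommGroup H] [InnerProductSpace ℂ H]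
  [CompleteSpace H] {E : QuantizedDomain Γ H}

/-! Concrete systems are abstract because membership in the cone at `α` is, for a hermitian matrix,
non-negativity of its quadratic form on `H_α^n` (`mem_cone_iff`). A larger subspace gives a smaller
cone, `r e_n` has the form `r‖ξ‖²`, and a form that vanishes on every `H_α^n` belongs to the zero
matrix, by polarization and because `D` is the union of the `H_α`.

Conversely, an abstract system acts on the direct sum of all its matrix states: unital maps `φ : V →
B(ℂ^m)` that are completely positive for at least one index `α`. Let `H_α` be the families supported
on the states that are completely positive for `α`. A smaller cone has more states, so the filtered
cones give directed subspaces. The order unit bounds `φ(v)` uniformly over the states at `α`, so the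
direct sum is bounded on `H_α`; being block diagonal, it commutes with `P_α`.

The embedding property then says that the matrix states at `α` detect `C α n`
(`exists_isMatrixState_not_nonneg`). A hermitian `A` outside this cone is separated from it by a
state `F` on `M_n(V)`, through M. Riesz extension and the Archimedean property (`exists_state_neg`).
The functional `F` corresponds to a completely positive map `V → M_n`, which becomes unital after a
small perturbation and a compression. Thus `ℂ^n` suffices at level `n`; using only
finite-dimensional states also keeps the Hilbert space in the universe of `V`. -/

theorem restrict_add (S T : E.CStar) (α : Γ) :
    restrict (S + T) α = restrict S α + restrict T α := rfl

theorem restrict_smul (c : ℂ) (T : E.CStar) (α : Γ) : restrict (c • T) α = c • restrict T α := rfl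

theorem restrict_zero (α : Γ) : restrict (0 : E.CStar) α = 0 := rfl

theorem restrict_one (α : Γ) : restrict (1 : E.CStar) α = 1 := rfl

theorem restrict_neg (T : E.CStar) (α : Γ) : restrict (-T) α = -restrict T α := rfl

theorem restrict_sum {ι : Type*} (s : Finset ι) (T : ι → E.CStar) (α : Γ) :
    restrict (∑ i ∈ s, T i) α = ∑ i ∈ s, restrict (T i) α :=
  map_sum (AddMonoidHom.mk' (fun T : E.CStar => restrict T α) fun S T => restrict_add S T α) T s

theorem inner_restrict_left (T : E.CStar) (α : Γ) (x y : E.space α) :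
    ⟪restrict T α x, y⟫_ℂ = ⟪x, restrict (star T) α y⟫_ℂ :=
  star_inner' T ⟨x, E.space_le_domain α x.2⟩ ⟨y, E.space_le_domain α y.2⟩

theorem ext_of_restrict {S T : E.CStar} (h : ∀ α, restrict S α = restrict T α) : S = T := by
  refine Subtype.ext (LinearMap.ext fun x => Subtype.ext ?_)
  obtain ⟨α, hα⟩ := E.mem_domain.mp x.2
  have := congrArg (Subtype.val : E.space α → H) (DFunLike.congr_fun (h α) ⟨x, hα⟩)
  exact this

theorem inner_matrixRestrict {n : ℕ} (A : Matrix (Fin n) (Fin n) E.CStar) (α : Γ)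
    (ξ η : PiLp 2 (fun _ : Fin n => E.space α)) :
    ⟪ξ, matrixRestrict A α η⟫_ℂ = ∑ i, ∑ j, ⟪ξ i, restrict (A i j) α (η j)⟫_ℂ := by
  simp only [PiLp.inner_apply, matrixRestrict_apply, inner_sum]

theorem isSymmetric_matrixRestrict {n : ℕ} {A : Matrix (Fin n) (Fin n) E.CStar} (hA : star A = A)
    (α : Γ) : (matrixRestrict A α : PiLp 2 (fun _ : Fin n => E.space α) →ₗ[ℂ] _).IsSymmetric := by
  intro ξ η
  change ⟪matrixRestrict A α ξ, η⟫_ℂ = ⟪ξ, matrixRestrict A α η⟫_ℂ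
  rw [← inner_conj_symm, inner_matrixRestrict, inner_matrixRestrict, Finset.sum_comm]
  simp only [map_sum, inner_conj_symm, inner_restrict_left]
  refine Finset.sum_congr rfl fun i _ => Finset.sum_congr rfl fun j _ => ?_
  rw [show star (A j i) = A i j from congrFun (congrFun hA i) j]

/-- A hermitian matrix over `C*_E(D)` lies in the cone `K α n` exactly when its quadratic form on
`H_α^n` is non-negative. -/
theorem mem_cone_iff {α : Γ} {n : ℕ} {A : Matrix (Fin n) (Fin n) E.CStar} :
    A ∈ E.cone α n ↔ star A = A ∧
      ∀ ξ : Fin n → E.space α, 0 ≤ ∑ i, ∑ j, ⟪ξ i, restrict (A i j) α (ξ j)⟫_ℂ := by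
  refine and_congr_right fun hA => ?_
  have hs := isSymmetric_matrixRestrict hA α
  rw [ContinuousLinearMap.isPositive_iff]
  constructor
  · intro h ξ
    have h1 := h.2 (WithLp.toLp 2 ξ)
    have h2 := hs (WithLp.toLp 2 ξ) (WithLp.toLp 2 ξ)
    erw [h2, inner_matrixRestrict] at h1
    exact h1
  · intro h
    refine ⟨hs, fun ξ => ?_⟩
    have h2 := hs ξ ξ
    erw [h2, inner_matrixRestrict]
    exact h fun i => ξ i

theorem isCone_cone (α : Γ) (n : ℕ) : IsCone (E.cone α n) where
  zero_mem := mem_cone_iff.2 ⟨star_zero _, fun ξ => by simp [restrict_zero]⟩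
  add_mem A hA B hB := by
    rw [mem_cone_iff] at *
    refine ⟨by rw [star_add, hA.1, hB.1], fun ξ => ?_⟩
    simpa [restrict_add, inner_add_right, Finset.sum_add_distrib] using
      add_nonneg (hA.2 ξ) (hB.2 ξ)
  smul_mem r hr A hA := by
    rw [mem_cone_iff] at *
    refine ⟨by rw [star_smul, hA.1]; simp, fun ξ => ?_⟩
    have := mul_nonneg (Complex.zero_le_real.2 hr) (hA.2 ξ)
    simpa only [Matrix.smul_apply, restrict_smul, smul_apply, inner_smul_right,
      ← Finset.mul_sum] using this

theorem star_conj {V : Type*} [AddCommGroup V] [Module ℂ V] [StarAddMonoid V] [StarModule ℂ V]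
    {n m : ℕ} (X : Matrix (Fin n) (Fin m) ℂ) (A : Matrix (Fin n) (Fin n) V) :
    star (conj X A) = conj X (star A) := by
  ext i j
  change star (∑ k, ∑ l, (star (X k j) * X l i) • A k l) =
    ∑ k, ∑ l, (star (X k i) * X l j) • star (A l k)
  rw [Finset.sum_comm]
  simp only [star_sum, star_smul, star_mul', star_star]
  exact Finset.sum_congr rfl fun i _ => Finset.sum_congr rfl fun j _ => by rw [mul_comm]

theorem conj_mem_cone {α : Γ} {n m : ℕ} (X : Matrix (Fin n) (Fin m) ℂ)
    {A : Matrix (Fin n) (Fin n) E.CStar} (hA : A ∈ E.cone α n) : conj X A ∈ E.cone α m := by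
  rw [mem_cone_iff] at *
  refine ⟨by rw [star_conj, hA.1], fun ξ => ?_⟩
  convert hA.2 fun k => ∑ i, X k i • ξ i using 1
  simp only [conj, Matrix.of_apply, restrict_sum, restrict_smul, sum_apply,
    smul_apply, inner_sum, inner_smul_right, sum_inner, inner_smul_left,
    map_sum, map_smul, Finset.mul_sum]
  calc _ = ∑ i, ∑ k, ∑ j, ∑ l, star (X k i) * X l j * ⟪ξ i, restrict (A k l) α (ξ j)⟫_ℂ :=
        Finset.sum_congr rfl fun i _ => Finset.sum_comm
    _ = ∑ k, ∑ i, ∑ l, ∑ j, star (X k i) * X l j * ⟪ξ i, restrict (A k l) α (ξ j)⟫_ℂ := by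
        rw [Finset.sum_comm]
        exact Finset.sum_congr rfl fun k _ => Finset.sum_congr rfl fun i _ => Finset.sum_comm
    _ = _ := by
        refine Finset.sum_congr rfl fun k _ => ?_
        rw [Finset.sum_comm]
        refine Finset.sum_congr rfl fun l _ => ?_
        rw [Finset.sum_comm]
        refine Finset.sum_congr rfl fun j _ => Finset.sum_congr rfl fun i _ => ?_
        simp only [starRingEnd_apply]
        ring

theorem eq_zero_of_mem_cone {n : ℕ} {A : Matrix (Fin n) (Fin n) E.CStar}
    (h : ∀ α, A ∈ E.cone α n ∧ -A ∈ E.cone α n) : A = 0 := by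
  ext i j
  refine ext_of_restrict fun α => ?_
  have hs := isSymmetric_matrixRestrict (h α).1.1 α
  have hz : matrixRestrict A α = 0 := by
    -- Over `ℂ`, an operator whose quadratic form vanishes is zero.
    refine ContinuousLinearMap.coe_injective (inner_map_self_eq_zero _ |>.1 fun ξ => ?_)
    have h1 := (mem_cone_iff.1 (h α).1).2 fun i => ξ i
    have h2 := (mem_cone_iff.1 (h α).2).2 fun i => ξ i
    simp only [Matrix.neg_apply, restrict_neg, neg_apply, inner_neg_right,
      Finset.sum_neg_distrib, Left.nonneg_neg_iff] at h2
    rw [hs]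
    exact (inner_matrixRestrict A α ξ ξ).trans (le_antisymm h2 h1)
  ext1 x
  have h3 := matrixRestrict_apply A α (PiLp.single 2 j x) i
  rw [hz, Finset.sum_eq_single j (fun k _ hk => by simp [hk]) (by simp)] at h3
  simpa [restrict_zero] using h3.symm

/-- The form on `H_α^n` is the restriction of the form on `H_γ^n`. This turns directed subspaces
into downward filtered cones. -/
theorem cone_anti {α γ : Γ} (h : E.space α ≤ E.space γ) (n : ℕ) : E.cone γ n ⊆ E.cone α n := by
  intro A hA
  rw [mem_cone_iff] at *
  exact ⟨hA.1, fun ξ => hA.2 fun i => ⟨ξ i, h (ξ i).2⟩⟩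

theorem star_diagonal_one (n : ℕ) :
    star (Matrix.diagonal fun _ : Fin n => (1 : E.CStar)) = Matrix.diagonal fun _ => 1 := by
  rw [Matrix.star_eq_conjTranspose, Matrix.diagonal_conjTranspose]
  simp [Pi.star_def]

theorem sum_inner_restrict_diagonal_one {α : Γ} {n : ℕ} (r : ℝ)
    (A : Matrix (Fin n) (Fin n) E.CStar) (ξ : Fin n → E.space α) :
    ∑ i, ∑ j, ⟪ξ i, restrict (((r : ℂ) • (Matrix.diagonal fun _ : Fin n => (1 : E.CStar)) + A) i j)
      α (ξ j)⟫_ℂ = ((r * ‖WithLp.toLp 2 ξ‖ ^ 2 : ℝ) : ℂ) +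
        ∑ i, ∑ j, ⟪ξ i, restrict (A i j) α (ξ j)⟫_ℂ := by
  simp only [Matrix.add_apply, restrict_add, add_apply, inner_add_right, Finset.sum_add_distrib,
    Matrix.smul_apply, restrict_smul, smul_apply, inner_smul_right, ← Finset.mul_sum]
  congr 1
  rw [PiLp.norm_sq_eq_of_L2]
  push_cast
  congr 1
  refine Finset.sum_congr rfl fun i _ => ?_
  rw [Finset.sum_eq_single i (fun k _ hk => by simp [Matrix.diagonal_apply_ne _ hk.symm,
    restrict_zero]) (by simp)]
  simp [restrict_one, inner_self_eq_norm_sq_to_K]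

theorem exists_sub_mem_cone {n : ℕ} {A : Matrix (Fin n) (Fin n) E.CStar} (hA : star A = A)
    (α : Γ) : ∃ r : ℝ, 0 < r ∧
      (r : ℂ) • (Matrix.diagonal fun _ : Fin n => (1 : E.CStar)) - A ∈ E.cone α n := by
  -- The operator norm dominates the quadratic form; the `1` makes the constant strictly positive.
  refine ⟨‖matrixRestrict A α‖ + 1, by positivity, ?_⟩
  rw [mem_cone_iff]
  refine ⟨by rw [star_sub, star_smul, star_diagonal_one, hA]; simp, fun ξ => ?_⟩
  rw [sub_eq_add_neg, sum_inner_restrict_diagonal_one]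
  have h1 := inner_matrixRestrict A α (WithLp.toLp 2 ξ) (WithLp.toLp 2 ξ)
  have h2 := isSymmetric_matrixRestrict hA α
  have h3 : (⟪WithLp.toLp 2 ξ, matrixRestrict A α (WithLp.toLp 2 ξ)⟫_ℂ).im = 0 :=
    h2.im_inner_self_apply _
  have h4 : (⟪WithLp.toLp 2 ξ, matrixRestrict A α (WithLp.toLp 2 ξ)⟫_ℂ).re ≤
      ‖matrixRestrict A α‖ * ‖WithLp.toLp 2 ξ‖ ^ 2 := by
    refine (Complex.re_le_norm _).trans ((norm_inner_le_norm _ _).trans ?_)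
    calc _ ≤ ‖WithLp.toLp 2 ξ‖ * (‖matrixRestrict A α‖ * ‖WithLp.toLp 2 ξ‖) := by
          gcongr
          exact ContinuousLinearMap.le_opNorm _ _
      _ = _ := by ring
  simp only [Matrix.neg_apply, restrict_neg, neg_apply, inner_neg_right, Finset.sum_neg_distrib]
  change _ = ∑ i, ∑ j, ⟪ξ i, restrict (A i j) α (ξ j)⟫_ℂ at h1
  rw [← h1, Complex.nonneg_iff]
  simp only [Complex.add_re, Complex.add_im, Complex.neg_re, Complex.neg_im, Complex.ofReal_re,
    Complex.ofReal_im, h3]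
  refine ⟨?_, by simp⟩
  nlinarith [sq_nonneg ‖WithLp.toLp 2 ξ‖]

theorem mem_cone_of_forall_pos {α : Γ} {n : ℕ} {A : Matrix (Fin n) (Fin n) E.CStar}
    (h : ∀ r : ℝ, 0 < r →
      (r : ℂ) • (Matrix.diagonal fun _ : Fin n => (1 : E.CStar)) + A ∈ E.cone α n) :
    A ∈ E.cone α n := by
  simp only [mem_cone_iff] at *
  refine ⟨?_, fun ξ => ?_⟩
  · have := (h 1 one_pos).1
    rw [star_add, star_smul, star_diagonal_one] at this
    simpa using this
  · have h1 : ∀ r : ℝ, 0 < r → 0 ≤ ((r * ‖WithLp.toLp 2 ξ‖ ^ 2 : ℝ) : ℂ) +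
        ∑ i, ∑ j, ⟪ξ i, restrict (A i j) α (ξ j)⟫_ℂ := fun r hr => by
      rw [← sum_inner_restrict_diagonal_one]
      exact (h r hr).2 ξ
    generalize ∑ i, ∑ j, ⟪ξ i, restrict (A i j) α (ξ j)⟫_ℂ = z at h1
    simp only [Complex.nonneg_iff, Complex.add_re, Complex.add_im, Complex.ofReal_re,
      Complex.ofReal_im, zero_add] at h1 ⊢
    refine ⟨le_of_forall_pos_le_add fun ε hε => ?_, (h1 1 one_pos).2⟩
    -- With this `r` the perturbation `r‖ξ‖²` is at most `ε`; the `+ 1` covers `ξ = 0`.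
    have h2 := (h1 (ε / (‖WithLp.toLp 2 ξ‖ ^ 2 + 1)) (by positivity)).1
    have h3 : ε / (‖WithLp.toLp 2 ξ‖ ^ 2 + 1) * ‖WithLp.toLp 2 ξ‖ ^ 2 ≤ ε := by
      rw [div_mul_eq_mul_div, div_le_iff₀ (by positivity)]
      nlinarith
    linarith

end QuantizedDomain

/-! ### Passage from `C*_E(D)` to its unital self-adjoint subspaces -/

namespace Concrete

variable {Γ : Type v} {H : Type u} [NormedAddCommGroup H] [InnerProductSpace ℂ H]
  [CompleteSpace H] {E : QuantizedDomain Γ H} (S : Concrete E)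

theorem map_val_injective (n : ℕ) : Function.Injective
    fun A : Matrix (Fin n) (Fin n) S.carrier => A.map (Subtype.val : S.carrier → E.CStar) :=
  Matrix.map_injective Subtype.val_injective

theorem map_val_smul_unit_add {n : ℕ} (r : ℂ) (A : Matrix (Fin n) (Fin n) S.carrier) :
    (r • (Matrix.diagonal fun _ : Fin n => S.unit) + A).map (Subtype.val : S.carrier → E.CStar) =
      r • (Matrix.diagonal fun _ : Fin n => (1 : E.CStar)) +
        A.map (Subtype.val : S.carrier → E.CStar) := by
  ext1 i j
  by_cases h : i = j
  · subst h
    simp [unit]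
  · simp [Matrix.one_apply_ne h, Matrix.diagonal_apply_ne (fun _ => S.unit) h]

theorem map_val_conj {n m : ℕ} (X : Matrix (Fin n) (Fin m) ℂ)
    (A : Matrix (Fin n) (Fin n) S.carrier) :
    (conj X A).map (Subtype.val : S.carrier → E.CStar) =
      conj X (A.map (Subtype.val : S.carrier → E.CStar)) := by
  ext1 i j
  change S.carrier.subtype (∑ k, ∑ l, (star (X k i) * X l j) • A k l) = _
  simp [conj, map_sum]

theorem star_eq_iff {n : ℕ} {A : Matrix (Fin n) (Fin n) S.carrier} :
    star A = A ↔ star (A.map (Subtype.val : S.carrier → E.CStar)) =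
      A.map (Subtype.val : S.carrier → E.CStar) :=
  (S.map_val_injective n).eq_iff.symm

/-- Every concrete local operator system is an abstract one. -/
theorem isAbstract : IsAbstract S.cone S.unit where
  ordering := by
    have hf : ∀ α β, ∃ γ, ∀ n, S.cone γ n ⊆ S.cone α n ∧ S.cone γ n ⊆ S.cone β n := by
      intro α β
      obtain ⟨γ, h1, h2⟩ := E.directed α β
      exact ⟨γ, fun n => ⟨fun A hA => QuantizedDomain.cone_anti h1 n hA,
        fun A hA => QuantizedDomain.cone_anti h2 n hA⟩⟩
    refine ⟨fun n => ⟨E.nonempty, fun α β => ?_, fun α => ⟨?_, ?_, ?_⟩, ?_, ?_⟩, hf, ?_⟩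
    · obtain ⟨γ, hγ⟩ := hf α β
      exact ⟨γ, hγ n⟩
    · exact (QuantizedDomain.isCone_cone α n).zero_mem
    · exact fun A hA B hB => (QuantizedDomain.isCone_cone α n).add_mem _ hA _ hB
    · exact fun r hr A hA => (QuantizedDomain.isCone_cone α n).smul_mem r hr _ hA
    · exact fun α A hA => S.star_eq_iff.2 hA.1
    · ext A
      constructor
      · exact fun h => S.map_val_injective n (QuantizedDomain.eq_zero_of_mem_cone h)
      · rintro rfl α
        rw [neg_zero, and_self]
        exact (QuantizedDomain.isCone_cone α n).zero_mem
    · intro α n m X A hA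
      change (conj X A).map _ ∈ E.cone α m
      rw [map_val_conj]
      exact QuantizedDomain.conj_mem_cone X hA
  star_unit := Subtype.ext (star_one E.CStar)
  unit n := by
    refine ⟨⟨?_, fun A hA α => ?_⟩, fun α A h => ?_⟩
    · rw [star_eq_iff]
      have := S.map_val_smul_unit_add 1 (0 : Matrix (Fin n) (Fin n) S.carrier)
      simp only [one_smul, add_zero] at this
      rw [this]
      convert QuantizedDomain.star_diagonal_one n using 2 <;> ext1 i j <;> simp
    · obtain ⟨r, hr, h⟩ := QuantizedDomain.exists_sub_mem_cone (S.star_eq_iff.1 hA) α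
      refine ⟨r, hr, ?_⟩
      change Matrix.map _ _ ∈ E.cone α n
      rw [sub_eq_add_neg, map_val_smul_unit_add]
      rwa [sub_eq_add_neg] at h
    · refine QuantizedDomain.mem_cone_of_forall_pos fun r hr => ?_
      rw [← map_val_smul_unit_add]
      exact h r hr

end Concrete

/-! ## Separation of hermitian elements from Archimedean cones -/

section Separation

variable {W : Type*} [AddCommGroup W] [Module ℂ W]

theorem IsCone.real_smul_mem {K : Set W} (hK : IsCone K) {r : ℝ} (hr : 0 ≤ r) {v : W}
    (hv : v ∈ K) : r • v ∈ K := hK.smul_mem r hr v hv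

theorem IsCone.mem_of_smul_mem {K : Set W} (hK : IsCone K) {r : ℝ} (hr : 0 < r) {v : W}
    (hv : r • v ∈ K) : v ∈ K := by
  simpa [smul_smul, inv_mul_cancel₀ hr.ne'] using hK.real_smul_mem (inv_nonneg.2 hr.le) hv

variable [StarAddMonoid W] [StarModule ℂ W]

/-- The cone of all `x` whose hermitian part lies in `K - ℝ≥0 a`. -/
def enlargedCone {K : Set W} (hK : IsCone K) (a : W) : PointedCone ℝ W where
  carrier := {x | ∃ c : ℝ, 0 ≤ c ∧ x + star x + c • a ∈ K}
  add_mem' := by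
    rintro x y ⟨c, hc, hx⟩ ⟨d, hd, hy⟩
    refine ⟨c + d, add_nonneg hc hd, ?_⟩
    convert hK.add_mem _ hx _ hy using 1
    rw [star_add, add_smul]
    abel
  zero_mem' := ⟨0, le_rfl, by simpa using hK.zero_mem⟩
  smul_mem' := by
    rintro ⟨r, hr⟩ x ⟨c, hc, hx⟩
    refine ⟨r * c, mul_nonneg hr hc, ?_⟩
    change r • x + star (r • x) + (r * c) • a ∈ K
    have h : star (r • x) = r • star x := by
      change star ((r : ℂ) • x) = (r : ℂ) • star x
      simp
    rw [h, mul_smul, ← smul_add, ← smul_add]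
    exact hK.real_smul_mem hr hx

theorem mem_enlargedCone {K : Set W} (hK : IsCone K) (a x : W) :
    x ∈ enlargedCone hK a ↔ ∃ c : ℝ, 0 ≤ c ∧ x + star x + c • a ∈ K := Iff.rfl

/-- A hermitian element outside a cone with Archimedean order unit is separated from it by a
hermitian state. -/
theorem exists_state_neg {K : Set W} (hK : IsCone K) (herm : ∀ v ∈ K, star v = v) {e : W}
    (unit : ∀ v : W, star v = v → ∃ r : ℝ, 0 < r ∧ (r : ℂ) • e - v ∈ K)
    (arch : ∀ v : W, (∀ r : ℝ, 0 < r → (r : ℂ) • e + v ∈ K) → v ∈ K)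
    {a : W} (ha : star a = a) (haK : a ∉ K) :
    ∃ F : W →ₗ[ℂ] ℂ, (∀ x, F (star x) = star (F x)) ∧ (∀ x ∈ K, 0 ≤ F x) ∧ F e = 1 ∧
      (F a).re < 0 := by
  -- The Archimedean property leaves room: `r e + a` is still outside `K`. Separating this element
  -- instead of `a` makes the value at `a` strictly negative.
  obtain ⟨r, hr, hra⟩ : ∃ r : ℝ, 0 < r ∧ r • e + a ∉ K := by
    by_contra! h
    exact haK (arch a h)
  have he : e ∈ K := by
    obtain ⟨t, ht, h⟩ := unit 0 (star_zero W)
    exact hK.mem_of_smul_mem ht (by simpa using h)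
  -- If `-e` were in `K`, the order unit property would put `a` in `K`.
  have hne : -e ∉ K := by
    intro h
    obtain ⟨t, ht, h1⟩ := unit (-a) (by rw [star_neg, ha])
    refine haK ?_
    convert hK.add_mem _ h1 _ (hK.real_smul_mem ht.le h) using 1
    change a = t • e - -a + t • -e
    rw [smul_neg]
    abel
  have he0 : e ≠ 0 := by
    rintro rfl
    exact hne (by simpa using hK.zero_mem)
  have hse : star e = e := herm e he
  have hsmul : ∀ (t : ℝ) (x : W), star (t • x) = t • star x := fun t x => by
    change star ((t : ℂ) • x) = (t : ℂ) • star x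
    simp
  -- M. Riesz extension of `t e ↦ t` from the line `ℝ e`.
  obtain ⟨g, hg, hgpos⟩ := riesz_extension (enlargedCone hK (r • e + a))
    (LinearPMap.mkSpanSingleton (σ := RingHom.id ℝ) e (1 : ℝ) he0)
    (by
      rintro ⟨x, hx⟩ hxK
      obtain ⟨t, rfl⟩ := Submodule.mem_span_singleton.1 hx
      obtain ⟨c, hc, h⟩ := (mem_enlargedCone _ _ _).1 hxK
      have hval := LinearPMap.mkSpanSingleton'_apply (σ := RingHom.id ℝ) e (1 : ℝ)
        (fun c hc => by simpa [he0] using hc) t hx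
      change _ = _ at hval
      change 0 ≤ (LinearPMap.mkSpanSingleton' (σ := RingHom.id ℝ) e (1 : ℝ) _) ⟨t • e, hx⟩
      rw [hval]
      simp only [RingHom.id_apply, smul_eq_mul, mul_one]
      -- For `t < 0`, membership reads `2t e + c (r e + a) ∈ K`. If `c = 0` this gives `-e ∈ K`;
      -- otherwise adding `-2t e ∈ K` gives `r e + a ∈ K`.
      by_contra! ht
      have h2 : c • (r • e + a) + (-(2 * t)) • e = t • e + star (t • e) + c • (r • e + a) +
          (-(4 * t)) • e := by
        rw [hsmul, hse]
        module
      rcases hc.eq_or_lt with rfl | hc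
      · refine hne (hK.mem_of_smul_mem (r := -(2 * t)) (by linarith) ?_)
        convert h using 1
        rw [hsmul, hse]
        module
      · refine hra (hK.mem_of_smul_mem hc ?_)
        convert hK.add_mem _ h _ (hK.real_smul_mem (r := -(2 * t)) (by linarith) he) using 1
        rw [hsmul, hse]
        module)
    (by
      -- The order unit makes `ℝ e` cofinal. The coefficient is `t / 2` because the enlarged cone
      -- tests `x + star x`, which doubles multiples of `e`.
      intro y
      obtain ⟨t, ht, h⟩ := unit (-(y + star y)) (by
        rw [star_neg, star_add, star_star, add_comm])
      refine ⟨⟨(t / 2) • e, Submodule.smul_mem _ _ (Submodule.mem_span_singleton_self e)⟩,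
        0, le_rfl, ?_⟩
      convert h using 1
      change (t / 2) • e + y + star ((t / 2) • e + y) + _ = t • e - _
      rw [star_add, hsmul, hse]
      module)
  have hge : g e = 1 := by
    have := hg ⟨e, Submodule.mem_span_singleton_self e⟩
    rwa [LinearPMap.mkSpanSingleton_apply] at this
  have hgK : ∀ x ∈ K, 0 ≤ g x := fun x hx => hgpos x ⟨0, le_rfl, by
    rw [herm x hx, zero_smul, add_zero]
    exact hK.add_mem _ hx _ hx⟩
  have hga : g a ≤ -r := by
    -- `c = 2` cancels `x + star x` exactly and leaves `0 ∈ K`.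
    have := hgpos (-(r • e + a)) ⟨2, zero_le_two, by
      convert hK.zero_mem using 1
      rw [star_neg, star_add, hsmul, hse, ha]
      module⟩
    rw [map_neg, map_add, map_smul, hge, smul_eq_mul] at this
    linarith
  -- For antihermitian `x` the sum `x + star x` is zero, so both `x` and `-x` lie in the enlarged
  -- cone. Hence the complexification of `g` is `*`-preserving and agrees with `g` on hermitian
  -- elements.
  have hganti : ∀ x, star x = -x → g x = 0 := fun x hx => by
    refine le_antisymm ?_ (hgpos x ⟨0, le_rfl, ?_⟩)
    · have := hgpos (-x) ⟨0, le_rfl, by simpa [hx] using hK.zero_mem⟩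
      rw [map_neg] at this
      linarith
    · simpa [hx] using hK.zero_mem
  have hFherm : ∀ x, star x = x → Module.Dual.extendRCLike (𝕜 := ℂ) g x = (g x : ℂ) := by
    intro x hx
    rw [Module.Dual.extendRCLike_apply, hganti ((RCLike.I : ℂ) • x) (by simp [star_smul, hx])]
    simp
  refine ⟨Module.Dual.extendRCLike (𝕜 := ℂ) g, fun x => ?_, fun x hx => ?_, ?_, ?_⟩
  · have h1 : g (star x) = g x := by
      have := hganti (x - star x) (by simp)
      rw [map_sub] at this
      linarith
    have h2 : g ((RCLike.I : ℂ) • star x) = -g ((RCLike.I : ℂ) • x) := by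
      have := hganti ((RCLike.I : ℂ) • x + (RCLike.I : ℂ) • star x) (by simp [star_smul])
      rw [map_add] at this
      linarith
    rw [Module.Dual.extendRCLike_apply, Module.Dual.extendRCLike_apply, h1, h2]
    simp
  · rw [hFherm x (herm x hx)]
    exact Complex.zero_le_real.2 (hgK x hx)
  · rw [hFherm e hse, hge, Complex.ofReal_one]
  · rw [hFherm a ha, Complex.ofReal_re]
    linarith

end Separation

/-! ## Matrix states -/

section MatrixState

variable {V : Type*} [AddCommGroup V] [Module ℂ V]

/-- A linear map `V → M_m` is completely positive for the matrix cones `C` if it maps each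
`A ∈ C n` to a positive semidefinite element of `M_n(M_m)`. -/
def IsCompletelyPositive (C : ∀ n : ℕ, Set (Matrix (Fin n) (Fin n) V)) {m : ℕ}
    (φ : V →ₗ[ℂ] Matrix (Fin m) (Fin m) ℂ) : Prop :=
  ∀ n, ∀ A ∈ C n, ∀ x : Fin n → Fin m → ℂ,
    0 ≤ ∑ k, ∑ l, star (x k) ⬝ᵥ (φ (A k l)).mulVec (x l)

theorem IsCompletelyPositive.add {C : ∀ n : ℕ, Set (Matrix (Fin n) (Fin n) V)} {m : ℕ}
    {φ ψ : V →ₗ[ℂ] Matrix (Fin m) (Fin m) ℂ} (hφ : IsCompletelyPositive C φ)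
    (hψ : IsCompletelyPositive C ψ) : IsCompletelyPositive C (φ + ψ) := fun n A hA x => by
  simpa [Matrix.add_mulVec, Finset.sum_add_distrib] using add_nonneg (hφ n A hA x) (hψ n A hA x)

theorem IsCompletelyPositive.smul {C : ∀ n : ℕ, Set (Matrix (Fin n) (Fin n) V)} {m : ℕ}
    {φ : V →ₗ[ℂ] Matrix (Fin m) (Fin m) ℂ} (hφ : IsCompletelyPositive C φ) {c : ℂ} (hc : 0 ≤ c) :
    IsCompletelyPositive C (c • φ) := fun n A hA x => by
  simpa only [LinearMap.smul_apply, Matrix.smul_mulVec, dotProduct_smul, smul_eq_mul,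
    ← Finset.mul_sum] using mul_nonneg hc (hφ n A hA x)

/-- The map `v ↦ tr (φ v) • 1`. -/
def traceMap {m : ℕ} (φ : V →ₗ[ℂ] Matrix (Fin m) (Fin m) ℂ) : V →ₗ[ℂ] Matrix (Fin m) (Fin m) ℂ :=
  (Matrix.traceLinearMap (Fin m) ℂ ℂ ∘ₗ φ).smulRight 1

theorem traceMap_apply {m : ℕ} (φ : V →ₗ[ℂ] Matrix (Fin m) (Fin m) ℂ) (v : V) :
    traceMap φ v = (φ v).trace • 1 := rfl

/-- `tr(φ) • 1` is the sum over `i, p` of the compressions of `φ` by the matrix units `x ↦ x_i e_p`,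
each of which is completely positive. -/
theorem IsCompletelyPositive.traceMap {C : ∀ n : ℕ, Set (Matrix (Fin n) (Fin n) V)} {m : ℕ}
    {φ : V →ₗ[ℂ] Matrix (Fin m) (Fin m) ℂ} (hφ : IsCompletelyPositive C φ) :
    IsCompletelyPositive C (traceMap φ) := fun n A hA x => by
  have h : 0 ≤ ∑ i, ∑ p, ∑ k, ∑ l, star (Pi.single (M := fun _ => ℂ) p (x k i)) ⬝ᵥ
      (φ (A k l)).mulVec (Pi.single p (x l i)) :=
    Finset.sum_nonneg fun i _ => Finset.sum_nonneg fun p _ => hφ n A hA _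
  convert h using 1
  calc _ = ∑ k, ∑ l, ∑ i, ∑ p, star (x k i) * φ (A k l) p p * x l i := by
        refine Finset.sum_congr rfl fun k _ => Finset.sum_congr rfl fun l _ => ?_
        rw [traceMap_apply, Matrix.smul_mulVec, Matrix.one_mulVec, dotProduct_smul]
        simp only [dotProduct, Matrix.trace, Matrix.diag, smul_eq_mul, Finset.sum_mul_sum]
        rw [Finset.sum_comm]
        refine Finset.sum_congr rfl fun i _ => Finset.sum_congr rfl fun p _ => ?_
        rw [Pi.star_apply]
        ring
    _ = ∑ i, ∑ p, ∑ k, ∑ l, star (x k i) * φ (A k l) p p * x l i := by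
        simp_rw [Finset.sum_comm (s := Finset.univ (α := Fin n)) (t := Finset.univ (α := Fin m))]
    _ = _ := by
        refine Finset.sum_congr rfl fun i _ => Finset.sum_congr rfl fun p _ =>
          Finset.sum_congr rfl fun k _ => Finset.sum_congr rfl fun l _ => ?_
        rw [← Pi.single_star, single_dotProduct, Matrix.mulVec_single]
        simp [mul_assoc]

/-- The map `V → M_n` that corresponds to a functional on `M_n(V)`. -/
def ofFunctional {n : ℕ} (F : Matrix (Fin n) (Fin n) V →ₗ[ℂ] ℂ) :
    V →ₗ[ℂ] Matrix (Fin n) (Fin n) ℂ where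
  toFun v := Matrix.of fun i j => F (Matrix.single i j v)
  map_add' v w := by
    ext i j
    simp [Matrix.single_add]
  map_smul' c v := by
    ext i j
    simp [← Matrix.smul_single]

/-- This reduces complete positivity of the associated map to positivity of `F`, since the cones are
stable under `A ↦ X* A X`. -/
theorem sum_ofFunctional {n m : ℕ} (F : Matrix (Fin n) (Fin n) V →ₗ[ℂ] ℂ)
    (A : Matrix (Fin m) (Fin m) V) (x : Fin m → Fin n → ℂ) :
    ∑ k, ∑ l, star (x k) ⬝ᵥ (ofFunctional F (A k l)).mulVec (x l) =
      F (conj (Matrix.of x) A) := by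
  have h : conj (Matrix.of x) A =
      ∑ k, ∑ l, ∑ i, ∑ j, (star (x k i) * x l j) • Matrix.single i j (A k l) := by
    ext i j
    simp only [conj, Matrix.of_apply, Matrix.sum_apply, Matrix.smul_apply, Matrix.single_apply,
      ite_and]
    simp
  rw [h]
  simp only [map_sum, map_smul, dotProduct, Matrix.mulVec, Finset.mul_sum, smul_eq_mul]
  refine Finset.sum_congr rfl fun k _ => Finset.sum_congr rfl fun l _ =>
    Finset.sum_congr rfl fun i _ => Finset.sum_congr rfl fun j _ => ?_
  simp only [ofFunctional, LinearMap.coe_mk, AddHom.coe_mk, Matrix.of_apply, Pi.star_apply]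
  ring

theorem conj_one {n : ℕ} (A : Matrix (Fin n) (Fin n) V) :
    conj (1 : Matrix (Fin n) (Fin n) ℂ) A = A := by
  ext i j
  simp [conj, Matrix.one_apply, apply_ite star, ite_smul]

theorem trace_ofFunctional {n : ℕ} (F : Matrix (Fin n) (Fin n) V →ₗ[ℂ] ℂ) (v : V) :
    (ofFunctional F v).trace = F (Matrix.diagonal fun _ => v) := by
  have h : (Matrix.diagonal fun _ : Fin n => v) = ∑ i, Matrix.single i i v := by
    ext i j
    simp [Matrix.sum_apply, Matrix.single_apply, Matrix.diagonal_apply, ite_and]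
  rw [h, map_sum]
  rfl

open scoped MatrixOrder in
theorem exists_isUnit_conjTranspose_mul_mul_eq_one {m : ℕ} {P : Matrix (Fin m) (Fin m) ℂ}
    (hP : P.PosDef) : ∃ R : Matrix (Fin m) (Fin m) ℂ, IsUnit R ∧ R.conjTranspose * P * R = 1 := by
  have h1 : CFC.sqrt P * CFC.sqrt P = P := CFC.sqrt_mul_sqrt_self P hP.posSemidef.nonneg
  have h2 : (CFC.sqrt P).conjTranspose = CFC.sqrt P :=
    (CFC.sqrt_nonneg P).isSelfAdjoint.star_eq
  have h3 : IsUnit (CFC.sqrt P) := by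
    have := hP.isUnit
    rw [← h1] at this
    exact isUnit_of_mul_isUnit_left this
  have h4 := (Matrix.isUnit_iff_isUnit_det _).1 h3
  -- `R = P^{-1/2}`.
  refine ⟨(CFC.sqrt P)⁻¹, (Matrix.isUnit_nonsing_inv_iff).2 h3, ?_⟩
  rw [Matrix.conjTranspose_nonsing_inv, h2]
  nth_rewrite 2 [← h1]
  rw [← mul_assoc, Matrix.nonsing_inv_mul _ h4, one_mul, Matrix.mul_nonsing_inv _ h4]

/-- A matrix state: a unital completely positive map from `V` to the operators on `ℂ^m`. -/
structure IsMatrixState (C : ∀ n : ℕ, Set (Matrix (Fin n) (Fin n) V)) (e : V) {m : ℕ}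
    (φ : V →ₗ[ℂ] (EuclideanSpace ℂ (Fin m) →L[ℂ] EuclideanSpace ℂ (Fin m))) : Prop where
  map_unit : φ e = 1
  nonneg : ∀ n, ∀ A ∈ C n, ∀ ξ : Fin n → EuclideanSpace ℂ (Fin m),
    0 ≤ ∑ k, ∑ l, ⟪ξ k, φ (A k l) (ξ l)⟫_ℂ

/-- The compression `v ↦ R* φ(v) R`, as a map into operators. -/
def compress {m : ℕ} (φ : V →ₗ[ℂ] Matrix (Fin m) (Fin m) ℂ) (R : Matrix (Fin m) (Fin m) ℂ) :
    V →ₗ[ℂ] (EuclideanSpace ℂ (Fin m) →L[ℂ] EuclideanSpace ℂ (Fin m)) where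
  toFun v := Matrix.toEuclideanCLM (𝕜 := ℂ) (R.conjTranspose * φ v * R)
  map_add' v w := by rw [map_add, mul_add, add_mul, map_add]
  map_smul' c v := by simp

theorem inner_compress {m : ℕ} (φ : V →ₗ[ℂ] Matrix (Fin m) (Fin m) ℂ)
    (R : Matrix (Fin m) (Fin m) ℂ) (v : V) (x y : EuclideanSpace ℂ (Fin m)) :
    ⟪x, compress φ R v y⟫_ℂ = star (R.mulVec x.ofLp) ⬝ᵥ (φ v).mulVec (R.mulVec y.ofLp) := by
  rw [EuclideanSpace.inner_eq_star_dotProduct, dotProduct_comm]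
  change star x.ofLp ⬝ᵥ (R.conjTranspose * φ v * R).mulVec y.ofLp = _
  rw [Matrix.star_mulVec, ← Matrix.dotProduct_mulVec, Matrix.mulVec_mulVec, Matrix.mulVec_mulVec,
    mul_assoc]

variable [StarAddMonoid V] [StarModule ℂ V]

/-- The matrix states of an Archimedean matrix ordering detect its cones. -/
theorem exists_isMatrixState_not_nonneg {C : ∀ n : ℕ, Set (Matrix (Fin n) (Fin n) V)} {e : V}
    (hcone : ∀ n, IsCone (C n)) (herm : ∀ n, ∀ A ∈ C n, star A = A)
    (hconj : ∀ (n m : ℕ) (X : Matrix (Fin n) (Fin m) ℂ), ∀ A ∈ C n, conj X A ∈ C m)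
    (hunit : ∀ n, ∀ A : Matrix (Fin n) (Fin n) V, star A = A →
      ∃ r : ℝ, 0 < r ∧ (r : ℂ) • (Matrix.diagonal fun _ => e) - A ∈ C n)
    (harch : ∀ n, ∀ A : Matrix (Fin n) (Fin n) V,
      (∀ r : ℝ, 0 < r → (r : ℂ) • (Matrix.diagonal fun _ => e) + A ∈ C n) → A ∈ C n)
    {n : ℕ} {A : Matrix (Fin n) (Fin n) V} (hA : star A = A) (hAC : A ∉ C n) :
    ∃ φ : V →ₗ[ℂ] (EuclideanSpace ℂ (Fin n) →L[ℂ] EuclideanSpace ℂ (Fin n)),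
      IsMatrixState C e φ ∧ ∃ ξ : Fin n → EuclideanSpace ℂ (Fin n),
        ¬ 0 ≤ ∑ k, ∑ l, ⟪ξ k, φ (A k l) (ξ l)⟫_ℂ := by
  obtain ⟨F, hFstar, hFC, hFe, hFA⟩ :=
    exists_state_neg (hcone n) (herm n) (hunit n) (harch n) hA hAC
  set φ := ofFunctional F with hφdef
  have hφ : IsCompletelyPositive C φ := fun m B hB x => by
    rw [hφdef, sum_ofFunctional]
    exact hFC _ (hconj m n _ B hB)
  have he1 : (Matrix.diagonal fun _ : Fin 1 => e) ∈ C 1 := by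
    obtain ⟨t, ht, h⟩ := hunit 1 0 (star_zero _)
    exact (hcone 1).mem_of_smul_mem ht (by simpa using h)
  have hse : star e = e := by
    simpa using congrFun (congrFun (herm 1 _ he1) 0) 0
  have hφe : (φ e).PosSemidef := by
    refine Matrix.PosSemidef.of_dotProduct_mulVec_nonneg ?_ fun x => ?_
    · ext i j
      change star (F (Matrix.single j i e)) = F (Matrix.single i j e)
      rw [← hFstar, Matrix.star_eq_conjTranspose, Matrix.conjTranspose_single, hse]
    · simpa using hφ 1 _ he1 fun _ => x
  -- `φ e` is only positive semidefinite, so `φ` cannot be normalized directly. Since `tr (φ e) =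
  -- F(e_n) = 1`, adding `ε tr(φ) • 1` adds `ε` to `φ e` and makes it definite. The number `z` is
  -- the effect of this term at `A`, and `ε` is small enough to keep the real part negative.
  set z : ℂ := ∑ k, ∑ l, star ((1 : Matrix (Fin n) (Fin n) ℂ) k) ⬝ᵥ
    (traceMap φ (A k l)).mulVec ((1 : Matrix (Fin n) (Fin n) ℂ) l) with hz
  obtain ⟨ε, hε, hεz⟩ : ∃ ε : ℝ, 0 < ε ∧ (F A).re + ε * z.re < 0 := by
    refine ⟨-(F A).re / (2 * (|z.re| + 1)), div_pos (by linarith) (by positivity), ?_⟩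
    have h1 : -(F A).re / (2 * (|z.re| + 1)) * z.re ≤ -(F A).re / 2 := by
      rw [div_mul_eq_mul_div, div_le_div_iff₀ (by positivity) two_pos]
      nlinarith [le_abs_self z.re]
    linarith
  set ψ := φ + (ε : ℂ) • traceMap φ with hψdef
  have hεC : (0 : ℂ) < (ε : ℂ) := by exact_mod_cast hε
  have hψ : IsCompletelyPositive C ψ := hφ.add (hφ.traceMap.smul hεC.le)
  have hψe : (ψ e).PosDef := by
    have h1 : ψ e = φ e + (ε : ℂ) • 1 := by
      rw [hψdef, LinearMap.add_apply, LinearMap.smul_apply, traceMap_apply, trace_ofFunctional,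
        hFe, one_smul]
    rw [h1]
    exact Matrix.PosDef.posSemidef_add hφe (Matrix.PosDef.one.smul hεC)
  obtain ⟨R, hR, hRe⟩ := exists_isUnit_conjTranspose_mul_mul_eq_one hψe
  refine ⟨compress ψ R, ⟨?_, fun m B hB ξ => ?_⟩,
    -- The vectors `R⁻¹ e_k` undo the compression, so the form takes the value `F A + ε z`.
    fun k => WithLp.toLp 2 (R⁻¹.mulVec ((1 : Matrix (Fin n) (Fin n) ℂ) k)), ?_⟩
  · change Matrix.toEuclideanCLM (𝕜 := ℂ) (R.conjTranspose * ψ e * R) = 1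
    rw [hRe, map_one]
  · simp only [inner_compress]
    exact hψ m B hB fun k => R.mulVec (ξ k).ofLp
  · have hRinv : ∀ x, R.mulVec (R⁻¹.mulVec x) = x := fun x => by
      rw [Matrix.mulVec_mulVec, Matrix.mul_nonsing_inv _ ((Matrix.isUnit_iff_isUnit_det _).1 hR),
        Matrix.one_mulVec]
    have h1 : ∑ k, ∑ l, star ((1 : Matrix (Fin n) (Fin n) ℂ) k) ⬝ᵥ
        (ψ (A k l)).mulVec ((1 : Matrix (Fin n) (Fin n) ℂ) l) = F A + ε * z := by
      simp only [hψdef, LinearMap.add_apply, LinearMap.smul_apply, Matrix.add_mulVec,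
        Matrix.smul_mulVec, dotProduct_add, dotProduct_smul, Finset.sum_add_distrib,
        ← Finset.mul_sum, smul_eq_mul, ← hz]
      congr 1
      exact (sum_ofFunctional F A _).trans (congrArg F (conj_one A))
    simp only [inner_compress, hRinv, h1]
    intro h
    have := (Complex.nonneg_iff.1 h).1
    simp at this
    linarith

end MatrixState

/-! ## Block diagonal operators on Hilbert space direct sums -/

namespace QuantizedDomain

section Block

variable {Γ : Type v} {ι : Type u} (G : ι → Type) [∀ i, NormedAddCommGroup (G i)]
  [∀ i, InnerProductSpace ℂ (G i)]

/-- The closed subspace of all families in the Hilbert space direct sum supported in `s`. -/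
def supported (s : Set ι) : Submodule ℂ (lp G 2) where
  carrier := {f | ∀ i ∉ s, f i = 0}
  add_mem' hf hg i hi := by
    rw [lp.coeFn_add, Pi.add_apply, hf i hi, hg i hi, add_zero]
  zero_mem' i _ := rfl
  smul_mem' c f hf i hi := by
    rw [lp.coeFn_smul, Pi.smul_apply, hf i hi, smul_zero]

variable {G}

theorem mem_supported {s : Set ι} {f : lp G 2} : f ∈ supported G s ↔ ∀ i ∉ s, f i = 0 := Iff.rfl

theorem supported_mono {s t : Set ι} (h : s ⊆ t) : supported G s ≤ supported G t :=
  fun _ hf i hi => hf i fun his => hi (h his)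

theorem isClosed_supported (s : Set ι) : IsClosed (supported G s : Set (lp G 2)) := by
  have : (supported G s : Set (lp G 2)) = ⋂ i ∈ sᶜ, (fun f : lp G 2 => f i) ⁻¹' {0} := by
    ext f
    simp [mem_supported]
  rw [this]
  exact isClosed_biInter fun i _ =>
    isClosed_singleton.preimage (lp.lipschitzWith_one_eval 2 i).continuous

open Classical in
theorem single_mem_supported {s : Set ι} {i : ι} (hi : i ∈ s) (x : G i) :
    lp.single 2 i x ∈ supported G s := fun j hj => by
  rw [lp.single_apply, Pi.single_eq_of_ne]
  rintro rfl
  exact hj hi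

variable (G) in
/-- The quantized domain of the subspaces supported in the members of a directed cover `s`. -/
def ofCover (s : Γ → Set ι) (hne : Nonempty Γ) (hdir : Directed (· ⊆ ·) s)
    (hcover : ∀ i, ∃ α, i ∈ s α) : QuantizedDomain Γ (lp G 2) where
  space α := supported G (s α)
  nonempty := hne
  isClosed_space α := isClosed_supported (s α)
  directed := fun α β => (hdir α β).imp fun _ h => ⟨supported_mono h.1, supported_mono h.2⟩
  dense_iUnion := by
    classical
    have hd : Directed (· ≤ ·) fun α => supported G (s α) :=
      fun α β => (hdir α β).imp fun _ h => ⟨supported_mono h.1, supported_mono h.2⟩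
    rw [dense_iff_closure_eq, Set.eq_univ_iff_forall]
    intro f
    -- Finite truncations converge to `f`, and by directedness each one lies in a single subspace of
    -- the family.
    refine mem_closure_of_tendsto (lp.hasSum_single (by simp) f)
      (Filter.Eventually.of_forall fun t => ?_)
    have hmem : ∑ i ∈ t, lp.single 2 i (f i) ∈ ⨆ α, supported G (s α) :=
      Submodule.sum_mem _ fun i _ => by
        obtain ⟨α, hα⟩ := hcover i
        exact Submodule.mem_iSup_of_mem α (single_mem_supported hα _)
    obtain ⟨α, hα⟩ := (Submodule.mem_iSup_of_directed _ hd).1 hmem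
    exact Set.mem_iUnion.2 ⟨α, hα⟩

variable {s : Γ → Set ι} {hne : Nonempty Γ} {hdir : Directed (· ⊆ ·) s} {hcover : ∀ i, ∃ α, i ∈ s α}

/-- Coordinatewise domination by a multiple of `f` gives both square summability and the bound on
`H_α`. The absolute value is needed because `M` may be negative when `t` is empty. -/
theorem norm_block_apply_le {t : Set ι} {T : ∀ i, G i →L[ℂ] G i} {M : ℝ} (hM : ∀ i ∈ t, ‖T i‖ ≤ M)
    {f : lp G 2} (hf : f ∈ supported G t) (i : ι) : ‖T i (f i)‖ ≤ ‖((|M| : ℝ) : ℂ) • f i‖ := by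
  by_cases hi : i ∈ t
  · rw [norm_smul, Complex.norm_real, Real.norm_eq_abs, abs_abs]
    refine (ContinuousLinearMap.le_opNorm _ _).trans ?_
    gcongr
    exact (hM i hi).trans (le_abs_self M)
  · simp [hf i hi]

theorem starProjection_supported_apply (t : Set ι) [(supported G t).HasOrthogonalProjection]
    (f : lp G 2) (i : ι) [Decidable (i ∈ t)] :
    (supported G t).starProjection f i = if i ∈ t then f i else 0 := by
  classical
  split_ifs with hi
  · refine ext_inner_left ℂ fun x => ?_
    have h := (supported G t).starProjection_inner_eq_zero f (lp.single 2 i x)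
      (single_mem_supported hi x)
    rw [← inner_eq_zero_symm, lp.inner_single_left, lp.coeFn_sub, Pi.sub_apply, inner_sub_right,
      sub_eq_zero] at h
    exact h.symm
  · exact (supported G t).starProjection_apply_mem f i hi

variable [∀ i, CompleteSpace (G i)]

instance instCompleteSpaceSupported (t : Set ι) : CompleteSpace (supported G t) :=
  (isClosed_supported t).completeSpace_coe

/-- The operator `(f i) ↦ (T i (f i))` for a family `T` that is bounded on each `s α`. -/
def blockDiagonal (T : ∀ i, G i →L[ℂ] G i) (hT : ∀ α, ∃ M : ℝ, ∀ i ∈ s α, ‖T i‖ ≤ M) :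
    (ofCover G s hne hdir hcover).CStar :=
  let E := ofCover G s hne hdir hcover
  have mem : ∀ f : E.domain, Memℓp (fun i => T i (f.1 i)) 2 := fun f => by
    obtain ⟨α, hα⟩ := E.mem_domain.1 f.2
    obtain ⟨M, hM⟩ := hT α
    exact ((lp.memℓp f.1).const_smul ((|M| : ℝ) : ℂ)).mono' (norm_block_apply_le hM hα)
  have supp : ∀ (f : E.domain) (α : Γ), f.1 ∈ E.space α →
      (⟨fun i => T i (f.1 i), mem f⟩ : lp G 2) ∈ E.space α := fun f α hf i hi => by
    change T i (f.1 i) = 0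
    rw [hf i hi, map_zero]
  ⟨{ toFun := fun f => ⟨⟨fun i => T i (f.1 i), mem f⟩, by
        obtain ⟨α, hα⟩ := E.mem_domain.1 f.2
        exact E.space_le_domain α (supp f α hα)⟩
     map_add' := fun f g => Subtype.ext <| lp.ext <| funext fun i => (T i).map_add _ _
     map_smul' := fun c f => Subtype.ext <| lp.ext <| funext fun i => (T i).map_smul _ _ }, by
    refine ⟨fun α => ⟨fun f hf => supp f α hf, ?_⟩, fun α f => ?_⟩
    · obtain ⟨M, hM⟩ := hT α
      refine ⟨|M|, fun f hf => ?_⟩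
      have h := lp.norm_mono (p := 2) (by simp) (x := (⟨fun i => T i (f.1 i), mem f⟩ : lp G 2))
        (y := ((|M| : ℝ) : ℂ) • f.1) (norm_block_apply_le hM hf)
      rw [norm_smul, Complex.norm_real, Real.norm_eq_abs, abs_abs] at h
      exact h
    · classical
      -- `P_α` deletes the coordinates outside `s α`, so it commutes with every coordinatewise
      -- operator.
      refine Subtype.ext <| lp.ext <| funext fun i => ?_
      change (supported G (s α)).starProjection _ i =
        T i ((supported G (s α)).starProjection f.1 i)
      rw [starProjection_supported_apply, starProjection_supported_apply]
      split_ifs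
      · rfl
      · rw [map_zero]⟩

theorem blockDiagonal_apply (T : ∀ i, G i →L[ℂ] G i) (hT : ∀ α, ∃ M : ℝ, ∀ i ∈ s α, ‖T i‖ ≤ M)
    (f : (ofCover G s hne hdir hcover).domain) (i : ι) :
    ((blockDiagonal T hT).1 f).1 i = T i (f.1 i) := rfl

theorem ext_of_apply {S T : (ofCover G s hne hdir hcover).CStar}
    (h : ∀ f i, (S.1 f).1 i = (T.1 f).1 i) : S = T :=
  Subtype.ext <| LinearMap.ext fun f => Subtype.ext <| lp.ext <| funext fun i => h f i

theorem star_blockDiagonal (S T : ∀ i, G i →L[ℂ] G i)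
    (hS : ∀ α, ∃ M : ℝ, ∀ i ∈ s α, ‖S i‖ ≤ M) (hT : ∀ α, ∃ M : ℝ, ∀ i ∈ s α, ‖T i‖ ≤ M)
    (h : ∀ i, S i = (T i).adjoint) :
    blockDiagonal (hne := hne) (hdir := hdir) (hcover := hcover) S hS =
      star (blockDiagonal T hT) := by
  refine ext_of_inner fun f g => ?_
  rw [star_inner]
  change ⟪((blockDiagonal S hS).1 f).1, g.1⟫_ℂ = ⟪f.1, ((blockDiagonal T hT).1 g).1⟫_ℂ
  rw [lp.inner_eq_tsum, lp.inner_eq_tsum]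
  refine tsum_congr fun i => ?_
  rw [blockDiagonal_apply, blockDiagonal_apply, h, ContinuousLinearMap.adjoint_inner_left]

theorem blockDiagonal_eq_one {T : ∀ i, G i →L[ℂ] G i} (hT : ∀ α, ∃ M : ℝ, ∀ i ∈ s α, ‖T i‖ ≤ M)
    (h : ∀ i, T i = 1) :
    blockDiagonal (hne := hne) (hdir := hdir) (hcover := hcover) T hT = 1 :=
  ext_of_apply fun f i => by
    rw [blockDiagonal_apply, h]
    rfl

/-- The direct sum of a family of linear maps into operators that is pointwise bounded on each
`s α`. -/
def blockDiagonalLinear {V : Type*} [AddCommGroup V] [Module ℂ V]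
    (φ : ∀ i, V →ₗ[ℂ] (G i →L[ℂ] G i)) (hφ : ∀ v α, ∃ M : ℝ, ∀ i ∈ s α, ‖φ i v‖ ≤ M) :
    V →ₗ[ℂ] (ofCover G s hne hdir hcover).CStar where
  toFun v := blockDiagonal (fun i => φ i v) (hφ v)
  map_add' v w := ext_of_apply fun f i => by
    rw [blockDiagonal_apply, map_add]
    rfl
  map_smul' c v := ext_of_apply fun f i => by
    rw [blockDiagonal_apply, map_smul]
    rfl

/-- Positivity of a hermitian matrix of block diagonal operators is decided blockwise. -/
theorem map_blockDiagonal_mem_cone_iff {n : ℕ} (T : Fin n → Fin n → ∀ i, G i →L[ℂ] G i)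
    (hT : ∀ k l α, ∃ M : ℝ, ∀ i ∈ s α, ‖T k l i‖ ≤ M) (hstar : ∀ k l i, T k l i = (T l k i).adjoint)
    (α : Γ) :
    (Matrix.of fun k l => blockDiagonal (T k l) (hT k l)) ∈ (ofCover G s hne hdir hcover).cone α n ↔
      ∀ i ∈ s α, ∀ ξ : Fin n → G i, 0 ≤ ∑ k, ∑ l, ⟪ξ k, T k l i (ξ l)⟫_ℂ := by
  classical
  rw [mem_cone_iff, and_iff_right]
  · have key : ∀ ξ : Fin n → (ofCover G s hne hdir hcover).space α,
        HasSum (fun i => ∑ k, ∑ l, ⟪(ξ k).1 i, T k l i ((ξ l).1 i)⟫_ℂ)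
          (∑ k, ∑ l, ⟪ξ k, restrict ((Matrix.of fun k l => blockDiagonal (T k l) (hT k l)) k l)
            α (ξ l)⟫_ℂ) := fun ξ =>
      hasSum_sum fun k _ => hasSum_sum fun l _ => lp.hasSum_inner (𝕜 := ℂ) (ξ k).1 _
    constructor
    · intro h i hi ξ
      -- Vectors concentrated in block `i` isolate its form.
      have h1 := h fun k => ⟨lp.single 2 i (ξ k), single_mem_supported hi (ξ k)⟩
      rw [← (key _).tsum_eq, tsum_eq_single i] at h1
      · simpa only [lp.single_apply_self] using h1
      · intro j hj
        simp [lp.single_apply, hj]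
    · intro h ξ
      refine (key ξ).nonneg fun i => ?_
      by_cases hi : i ∈ s α
      · exact h i hi fun k => (ξ k).1 i
      · have : ∀ k, (ξ k).1 i = 0 := fun k => (ξ k).2 i hi
        simp [this]
  · ext1 k l
    exact (star_blockDiagonal _ _ (hT k l) (hT l k) (hstar k l)).symm

end Block

end QuantizedDomain

/-! ## The representation theorem -/

/-! ### Matrix states preserve the involution and are uniformly bounded -/

section Bounds

variable {V : Type*} [AddCommGroup V] [Module ℂ V]
  {C : ∀ n : ℕ, Set (Matrix (Fin n) (Fin n) V)} {e : V} {m : ℕ}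
  {φ : V →ₗ[ℂ] (EuclideanSpace ℂ (Fin m) →L[ℂ] EuclideanSpace ℂ (Fin m))}

theorem IsMatrixState.map_nonneg (hφ : IsMatrixState C e φ) {v : V}
    (hv : (Matrix.of fun _ _ : Fin 1 => v) ∈ C 1) : 0 ≤ φ v := by
  rw [ContinuousLinearMap.nonneg_iff_isPositive, ContinuousLinearMap.isPositive_iff_complex]
  intro x
  have h := hφ.nonneg 1 _ hv fun _ => x
  simp only [Finset.univ_unique, Finset.sum_singleton, Matrix.of_apply] at h
  have h2 : 0 ≤ ⟪φ v x, x⟫_ℂ := by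
    rw [← inner_conj_symm, Complex.conj_eq_iff_im.2 (Complex.nonneg_iff.1 h).2.symm]
    exact h
  rw [Complex.nonneg_iff] at h2
  exact ⟨Complex.ext rfl h2.2, h2.1⟩

variable [StarAddMonoid V] (unit : ∀ A : Matrix (Fin 1) (Fin 1) V, star A = A →
  ∃ r : ℝ, 0 < r ∧ (r : ℂ) • (Matrix.diagonal fun _ => e) - A ∈ C 1)
include unit

theorem exists_smul_sub_mem {v : V} (hv : star v = v) :
    ∃ r : ℝ, 0 < r ∧ (Matrix.of fun _ _ : Fin 1 => (r : ℂ) • e - v) ∈ C 1 := by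
  obtain ⟨r, hr, h⟩ := unit (Matrix.of fun _ _ => v) (by
    ext
    exact hv)
  refine ⟨r, hr, ?_⟩
  convert h using 1
  ext i j
  simp [Subsingleton.elim i j]

theorem IsMatrixState.isSelfAdjoint_map (hφ : IsMatrixState C e φ) {v : V} (hv : star v = v) :
    IsSelfAdjoint (φ v) := by
  obtain ⟨r, -, h⟩ := exists_smul_sub_mem unit hv
  have h1 := (hφ.map_nonneg h).isSelfAdjoint
  rw [map_sub, map_smul, hφ.map_unit] at h1
  have h2 : IsSelfAdjoint ((r : ℂ) •
      (1 : EuclideanSpace ℂ (Fin m) →L[ℂ] EuclideanSpace ℂ (Fin m))) := by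
    rw [IsSelfAdjoint, star_smul, star_one]
    simp
  simpa using h2.sub h1

/-- If `r e - v` and `t e + v` are positive, then `0 ≤ r - φ v ≤ r + t` for every state `φ`. The
constants do not depend on `φ` or its dimension, which is what bounds the direct sum on `H_α`. -/
theorem exists_norm_le_of_star_eq {v : V} (hv : star v = v) :
    ∃ M : ℝ, ∀ (m : ℕ) (φ : V →ₗ[ℂ] (EuclideanSpace ℂ (Fin m) →L[ℂ] EuclideanSpace ℂ (Fin m))),
      IsMatrixState C e φ → ‖φ v‖ ≤ M := by
  obtain ⟨r, hr, h⟩ := exists_smul_sub_mem unit hv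
  obtain ⟨t, ht, h'⟩ := exists_smul_sub_mem unit (v := -v) (by rw [star_neg, hv])
  refine ⟨(r + t) + r, fun m φ hφ => ?_⟩
  have h1 := hφ.map_nonneg h
  have h2 := hφ.map_nonneg h'
  rw [map_sub, map_smul, hφ.map_unit] at h1 h2
  rw [map_neg, sub_neg_eq_add] at h2
  have h3 : ‖(r : ℂ) • (1 : EuclideanSpace ℂ (Fin m) →L[ℂ] EuclideanSpace ℂ (Fin m)) - φ v‖ ≤
      r + t := by
    rw [CStarAlgebra.norm_le_iff_le_algebraMap _ (by positivity) h1, ← sub_nonneg]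
    convert h2 using 1
    rw [Algebra.algebraMap_eq_smul_one, add_smul]
    change r • 1 + t • 1 - (r • 1 - φ v) = t • 1 + φ v
    abel
  have h4 : ‖(r : ℂ) • (1 : EuclideanSpace ℂ (Fin m) →L[ℂ] EuclideanSpace ℂ (Fin m))‖ ≤ r := by
    rw [norm_smul, Complex.norm_real, Real.norm_of_nonneg hr.le]
    exact mul_le_of_le_one_right hr.le ContinuousLinearMap.norm_id_le
  calc ‖φ v‖ = ‖(r : ℂ) • (1 : EuclideanSpace ℂ (Fin m) →L[ℂ] EuclideanSpace ℂ (Fin m)) -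
        ((r : ℂ) • 1 - φ v)‖ := by rw [sub_sub_cancel]
    _ ≤ _ := norm_sub_le _ _
    _ ≤ _ := by linarith

variable [StarModule ℂ V]
open scoped ComplexStarModule

theorem IsMatrixState.map_star (hφ : IsMatrixState C e φ) (v : V) : φ (star v) = star (φ v) := by
  have h1 := hφ.isSelfAdjoint_map unit (ℜ v).2
  have h2 := hφ.isSelfAdjoint_map unit (ℑ v).2
  have h3 : star (φ (ℜ v) + Complex.I • φ (ℑ v)) = φ (ℜ v) + star Complex.I • φ (ℑ v) := by
    refine (star_add (φ (ℜ v)) (Complex.I • φ (ℑ v))).trans ?_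
    rw [star_smul, h1.star_eq, h2.star_eq]
  have h4 : φ v = φ (ℜ v) + Complex.I • φ (ℑ v) := by
    rw [← map_smul, ← map_add, realPart_add_I_smul_imaginaryPart]
  rw [h4, h3, ← map_smul, ← map_add]
  nth_rewrite 1 [← realPart_add_I_smul_imaginaryPart v]
  rw [star_add, star_smul, (ℜ v).2.star_eq, (ℑ v).2.star_eq]

theorem exists_norm_le (v : V) :
    ∃ M : ℝ, ∀ (m : ℕ) (φ : V →ₗ[ℂ] (EuclideanSpace ℂ (Fin m) →L[ℂ] EuclideanSpace ℂ (Fin m))),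
      IsMatrixState C e φ → ‖φ v‖ ≤ M := by
  obtain ⟨M, hM⟩ := exists_norm_le_of_star_eq unit (ℜ v).2
  obtain ⟨N, hN⟩ := exists_norm_le_of_star_eq unit (ℑ v).2
  refine ⟨M + N, fun m φ hφ => ?_⟩
  rw [← realPart_add_I_smul_imaginaryPart v, map_add, map_smul]
  refine (norm_add_le _ _).trans (add_le_add (hM m φ hφ) ?_)
  rw [norm_smul, Complex.norm_I, one_mul]
  exact hN m φ hφ

end Bounds

/-! ### The universal representation -/

section Representation

open QuantizedDomain

variable {V : Type u} [AddCommGroup V] [Module ℂ V] [StarAddMonoid V]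
  {Γ : Type v} {C : Γ → ∀ n : ℕ, Set (Matrix (Fin n) (Fin n) V)} {e : V}

variable (C e) in
/-- All matrix states of a local operator system. -/
def MatrixStates : Type u :=
  {i : Σ m : ℕ, V →ₗ[ℂ] (EuclideanSpace ℂ (Fin m) →L[ℂ] EuclideanSpace ℂ (Fin m)) //
    ∃ α, IsMatrixState (C α) e i.2}

variable (C e) in
/-- The matrix states that are completely positive for the index `α`. -/
def statesAt (α : Γ) : Set (MatrixStates C e) := {i | IsMatrixState (C α) e i.1.2}

/-- Shrinking the cones enlarges the set of states. The index `γ` must serve all matrix levels at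
once. -/
theorem IsAbstract.directed_statesAt (hC : IsAbstract C e) :
    Directed (· ⊆ ·) (statesAt C e) := fun α β => by
  obtain ⟨γ, hγ⟩ := hC.ordering.filtered α β
  exact ⟨γ, fun _ hi => ⟨hi.map_unit, fun n A hA => hi.nonneg n A ((hγ n).1 hA)⟩,
    fun _ hi => ⟨hi.map_unit, fun n A hA => hi.nonneg n A ((hγ n).2 hA)⟩⟩

/-- The quantized domain built from the matrix states of a local operator system. -/
def IsAbstract.stateDomain (hC : IsAbstract C e) :
    QuantizedDomain Γ (lp (fun i : MatrixStates C e => EuclideanSpace ℂ (Fin i.1.1)) 2) :=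
  ofCover _ (statesAt C e) (hC.ordering.level 0).nonempty hC.directed_statesAt fun i => i.2

/-- The range of a unital `*`-preserving map as a concrete local operator system. -/
def IsOrderEmbedding.range {H : Type*} [NormedAddCommGroup H] [InnerProductSpace ℂ H]
    [CompleteSpace H] {E : QuantizedDomain Γ H} {Φ : V →ₗ[ℂ] E.CStar}
    (hΦ : IsOrderEmbedding C e E.cone 1 Φ) : Concrete E where
  carrier := LinearMap.range Φ
  one_mem := ⟨e, hΦ.map_unit⟩
  star_mem := by
    rintro _ ⟨v, rfl⟩
    exact ⟨star v, hΦ.map_star v⟩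

theorem IsOrderEmbedding.isOrderIso_rangeRestrict {H : Type*} [NormedAddCommGroup H]
    [InnerProductSpace ℂ H] [CompleteSpace H] {E : QuantizedDomain Γ H} {Φ : V →ₗ[ℂ] E.CStar}
    (hΦ : IsOrderEmbedding C e E.cone 1 Φ) :
    IsOrderIso C e hΦ.range.cone hΦ.range.unit Φ.rangeRestrict where
  injective _ _ h := hΦ.injective (congrArg Subtype.val h)
  map_star v := Subtype.ext (hΦ.map_star v)
  map_unit := Subtype.ext hΦ.map_unit
  mem_iff := hΦ.mem_iff
  surjective := Φ.surjective_rangeRestrict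

variable [StarModule ℂ V]

open scoped ComplexStarModule in
/-- A `*`-preserving linear map is injective if it is injective on hermitian elements. -/
theorem injective_of_map_star {W : Type*} [AddCommGroup W] [Module ℂ W] [StarAddMonoid W]
    {Φ : V →ₗ[ℂ] W} (hΦ : ∀ v, Φ (star v) = star (Φ v))
    (h : ∀ v, star v = v → Φ v = 0 → v = 0) : Function.Injective Φ := by
  refine (injective_iff_map_eq_zero _).2 fun v hv => ?_
  have hv' : Φ (star v) = 0 := by rw [hΦ, hv, star_zero]
  have h1 : (ℜ v : V) = 0 := h _ (ℜ v).2 (by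
    rw [realPart_apply_coe]
    change Φ ((((2 : ℝ)⁻¹ : ℝ) : ℂ) • (v + star v)) = 0
    rw [map_smul, map_add, hv, hv', add_zero, smul_zero])
  have h2 : (ℑ v : V) = 0 := h _ (ℑ v).2 (by
    rw [imaginaryPart_apply_coe]
    change Φ (-Complex.I • (((2 : ℝ)⁻¹ : ℝ) : ℂ) • (v - star v)) = 0
    rw [map_smul, map_smul, map_sub, hv, hv', sub_zero, smul_zero, smul_zero])
  rw [← realPart_add_I_smul_imaginaryPart v, h1, h2, smul_zero, add_zero]

theorem IsAbstract.exists_norm_le (hC : IsAbstract C e) (v : V) (α : Γ) :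
    ∃ M : ℝ, ∀ i ∈ statesAt C e α, ‖i.1.2 v‖ ≤ M := by
  obtain ⟨M, hM⟩ := LocalOperatorSystem.exists_norm_le (C := C α)
    (fun A hA => (hC.unit 1).exists_le A hA α) v
  exact ⟨M, fun i hi => hM _ _ hi⟩

theorem IsAbstract.state_star (hC : IsAbstract C e) (i : MatrixStates C e) (v : V) :
    i.1.2 (star v) = (i.1.2 v).adjoint := by
  obtain ⟨α, hα⟩ := i.2
  exact hα.map_star (fun A hA => (hC.unit 1).exists_le A hA α) v

/-- The universal representation: the direct sum of all matrix states. -/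
def IsAbstract.representation (hC : IsAbstract C e) : V →ₗ[ℂ] hC.stateDomain.CStar :=
  blockDiagonalLinear (fun i => i.1.2) hC.exists_norm_le

theorem IsAbstract.representation_star (hC : IsAbstract C e) (v : V) :
    hC.representation (star v) = star (hC.representation v) :=
  star_blockDiagonal _ _ (hC.exists_norm_le (star v)) (hC.exists_norm_le v)
    fun i => hC.state_star i v

/-- Positivity on `H_α^n` is positivity under every state at `α`, and these states detect the cone.
-/
theorem IsAbstract.mem_iff_of_star_eq (hC : IsAbstract C e) {n : ℕ}
    {A : Matrix (Fin n) (Fin n) V} (hA : star A = A) (α : Γ) :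
    A ∈ C α n ↔ A.map hC.representation ∈ hC.stateDomain.cone α n := by
  have h := map_blockDiagonal_mem_cone_iff (s := statesAt C e)
    (hne := (hC.ordering.level 0).nonempty) (hdir := hC.directed_statesAt)
    (hcover := fun i => i.2) (fun k l i => i.1.2 (A k l)) (fun k l => hC.exists_norm_le (A k l))
    (fun k l i => by rw [← hC.state_star, show star (A l k) = A k l from congrFun₂ hA k l]) α
  refine Iff.trans ⟨fun hAC i hi ξ => hi.nonneg n A hAC ξ, fun hpos => ?_⟩ h.symm
  by_contra hAC
  obtain ⟨φ, hφ, ξ, hξ⟩ := exists_isMatrixState_not_nonneg (C := C α) (e := e)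
    (fun n => (hC.ordering.level n).isCone α) (fun n => (hC.ordering.level n).hermitian α)
    (hC.ordering.compatible α) (fun n A hA => (hC.unit n).exists_le A hA α)
    (fun n => (hC.unit n).archimedean α) hA hAC
  -- The separating state is itself one of the blocks of `H_α`.
  exact hξ (hpos ⟨⟨n, φ⟩, α, hφ⟩ hφ ξ)

/-- If `v` is sent to `0`, both `v` and `-v` have image in every cone, so both lie in every `C α 1`,
and these cones have trivial common lineality space. -/
theorem IsAbstract.eq_zero_of_star_eq (hC : IsAbstract C e) {v : V} (hv : star v = v)
    (h : hC.representation v = 0) : v = 0 := by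
  have key : ∀ w : V, star w = w → hC.representation w = 0 → ∀ α,
      (Matrix.of fun _ _ : Fin 1 => w) ∈ C α 1 := fun w hw hw0 α => by
    rw [hC.mem_iff_of_star_eq (by
      ext
      exact hw)]
    convert (isCone_cone α 1).zero_mem using 1
    ext1 i j
    exact hw0
  have hmem : (Matrix.of fun _ _ : Fin 1 => v) ∈
      {w : Matrix (Fin 1) (Fin 1) V | ∀ α, w ∈ C α 1 ∧ -w ∈ C α 1} := fun α =>
    ⟨key v hv h α, key (-v) (by rw [star_neg, hv]) (by rw [map_neg, h, neg_zero]) α⟩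
  rw [(hC.ordering.level 1).inter_eq] at hmem
  exact congrFun₂ hmem 0 0

theorem IsAbstract.representation_injective (hC : IsAbstract C e) :
    Function.Injective hC.representation :=
  injective_of_map_star hC.representation_star fun _ => hC.eq_zero_of_star_eq

/-- The universal representation is a unital complete local order embedding. -/
theorem IsAbstract.isOrderEmbedding_representation (hC : IsAbstract C e) :
    IsOrderEmbedding C e hC.stateDomain.cone 1 hC.representation where
  injective := hC.representation_injective
  map_star := hC.representation_star
  map_unit := blockDiagonal_eq_one (hC.exists_norm_le e) fun i => by
    obtain ⟨α, hα⟩ := i.2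
    exact hα.map_unit
  mem_iff α n A := by
    by_cases hA : star A = A
    · exact hC.mem_iff_of_star_eq hA α
    -- Both cones contain only hermitian matrices, and injectivity pulls hermiticity of the image
    -- back to `A`.
    · refine iff_of_false (fun h => hA ((hC.ordering.level n).hermitian α A h)) fun h => hA ?_
      ext k l
      refine hC.representation_injective ?_
      have := congrFun₂ h.1 k l
      rw [Matrix.star_apply, Matrix.map_apply, ← hC.representation_star] at this
      exact this

end Representation

end LocalOperatorSystem

end

theorem mainTheorem1 :
    (∀ (V : Type u) [AddCommGroup V] [Module ℂ V] [StarAddMonoid V] [StarModule ℂ V]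
        (Γ : Type v) (C : Γ → ∀ n : ℕ, Set (Matrix (Fin n) (Fin n) V)) (e : V),
        LocalOperatorSystem.IsAbstract C e →
        ∃ (H : Type u) (_ : NormedAddCommGroup H) (_ : InnerProductSpace ℂ H)
          (_ : CompleteSpace H) (E : LocalOperatorSystem.QuantizedDomain Γ H)
          (Φ : V →ₗ[ℂ] E.CStar),
          LocalOperatorSystem.IsOrderEmbedding C e E.cone 1 Φ) ∧
    (∀ (V : Type u) [AddCommGroup V] [Module ℂ V] [StarAddMonoid V] [StarModule ℂ V]
        (Γ : Type v) (C : Γ → ∀ n : ℕ, Set (Matrix (Fin n) (Fin n) V)) (e : V),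
        LocalOperatorSystem.IsAbstract C e →
        ∃ (H : Type u) (_ : NormedAddCommGroup H) (_ : InnerProductSpace ℂ H)
          (_ : CompleteSpace H) (E : LocalOperatorSystem.QuantizedDomain Γ H)
          (S : LocalOperatorSystem.Concrete E) (Φ : V →ₗ[ℂ] S.carrier),
          LocalOperatorSystem.IsOrderIso C e S.cone S.unit Φ) ∧
    (∀ (Γ : Type v) (H : Type u) [NormedAddCommGroup H] [InnerProductSpace ℂ H]
        [CompleteSpace H] (E : LocalOperatorSystem.QuantizedDomain Γ H)
        (S : LocalOperatorSystem.Concrete E),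
        LocalOperatorSystem.IsAbstract S.cone S.unit) := by
  refine ⟨fun V _ _ _ _ Γ C e hC => ?_, fun V _ _ _ _ Γ C e hC => ?_, fun Γ H _ _ _ E S => ?_⟩
  · exact ⟨_, _, _, inferInstance, hC.stateDomain, hC.representation,
      hC.isOrderEmbedding_representation⟩
  · exact ⟨_, _, _, inferInstance, hC.stateDomain, hC.isOrderEmbedding_representation.range,
      _, hC.isOrderEmbedding_representation.isOrderIso_rangeRestrict⟩
  · exact S.isAbstract
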